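/- **Setting.** Let $\mathcal F$ be a convex subset of a real vector space $V$, let $K$ be a linear map from $V$ to a real Hilbert space $\mathcal Y$, let $L$ be a linear functional on $V$, and let $\sigma>0$, $\alpha\in(0,1)$. Under $P_f$, $f\in\mathcal F$, one observes $Y=Kf+\sigma\varepsilon$, where $\varepsilon$ is standard Gaussian on $\mathcal Y$: $\langle\varepsilon,h\rangle$ is almost surely linear in $h\in\mathcal Y$ and $\langle\varepsilon,h\rangle\sim N(0,\|h\|^2)$. (If $\mathcal Y$ is infinite-dimensional, $Y$ is understood as the family $(\langle Y,h\rangle)_{h\in\mathcal Y}$.) Let $\mathcal I_\alpha$ be the collection of all (jointly measurable) random sets $\mathcal C=\mathcal C(Y)\subseteq\mathbb R$ with $\inf_{f\in\mathcal F}P_f(Lf\in\mathcal C)\ge 1-\alpha$; let $\lambda$ be Lebesgue measure, and for sets $\mathcal A,\mathcal B\subseteq V$ let $$\omega(\delta;\mathcal A,\mathcal B)=\sup\{Lb-La:\ \|K(b-a)\|\le\delta,\ a\in\mathcal A,\ b\in\mathcal B\}\in[-\infty,\infty].$$ Let $Z$ be standard normal and $z_{1-\alpha}$ its $1-\alpha$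 quantile. **Theorem.** Let $g\in\mathcal F$, and suppose that for every $L_0\in\mathbb R$ a minimizer $f_{L_0}$ of $\|K(g-f)\|$ subject to $Lf=L_0$, $f\in\mathcal F$ exists. Let $\phi_{L_0}$ be the test that rejects when $\langle K(g-f_{L_0}),Y\rangle$ exceeds its $1-\alpha$ quantile under $f_{L_0}$. Say that a random set $\mathcal C(Y)$ inverts $\phi_{L_0}$ if, almost surely under $P_f$ for every $f\in\mathcal F$, $L_0\in\mathcal C(Y)$ if and only if $\phi_{L_0}$ does not reject. 1. There is a set $\mathcal C_g\in\mathcal I_\alpha$ that minimizes $E_g\lambda(\mathcal C)$ over $\mathcal C\in\mathcal I_\alpha$ and that inverts $\phi_{L_0}$ for $L_0=Lg$ and for every $L_0$ with $Kf_{L_0}\ne Kg$. Its expected length is $$E_g\lambda(\mathcal C_g)=(1-\alpha)\,E\big[\omega(\sigma(z_{1-\alpha}-Z);\mathcal F,\{g\})+\omega(\sigma(z_{1-\alpha}-Z);\{g\},\mathcal F)\,\big|\,Z\le z_{1-\alpha}\big]$$ (both sides may be $+\infty$). 2. Conversely, every minimizer of $E_g\lambda(\mathcal C)$ over $\mathcal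 I_\alpha$ with finite expected length inverts $\phi_{L_0}$ for almost every $L_0$ with $Kf_{L_0}\ne Kg$. 3. If $Kf_{L_0}\ne Kg$ for all $L_0\ne Lg$, then the expression in 1 is finite, and every jointly measurable $\mathcal C(Y)$ that inverts $\phi_{L_0}$ for all $L_0\in\mathbb R$ belongs to $\mathcal I_\alpha$, minimizes $E_g\lambda$ over $\mathcal I_\alpha$, and has this expected length. -/

import Mathlib

open MeasureTheory ProbabilityTheory

noncomputable section

namespace GaussianLinearModel

/-- The `p`-quantile `inf {x : μ (-∞, x] ≥ p}` of a probability measure on the line. -/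
def quantile (μ : Measure ℝ) (p : ℝ) : ℝ :=
  sInf {x : ℝ | p ≤ cdf μ x}

/-- Standard Gaussian noise on the inner product space `H`, given through the random variables
`ε h = ⟨ε, h⟩`: these are linear in `h` almost surely and `⟨ε, h⟩ ∼ N(0, ‖h‖²)`. (If `H` has
infinite dimension, such a noise is not a random element of `H`.) -/
structure IsStandardGaussianNoise {H Ω : Type*} [NormedAddCommGroup H] [InnerProductSpace ℝ H]
    [MeasurableSpace Ω] (P : Measure Ω) (ε : H → Ω → ℝ) : Prop where
  measurable : ∀ h, Measurable (ε h)
  map_add : ∀ h k, ∀ᵐ ω ∂P, ε (h + k) ω = ε h ω + ε k ω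
  map_smul : ∀ (a : ℝ) (h), ∀ᵐ ω ∂P, ε (a • h) ω = a * ε h ω
  law : ∀ h, P.map (ε h) = gaussianReal 0 (‖h‖₊ ^ 2)

section

variable {V H Ω : Type*} [AddCommGroup V] [Module ℝ V]
  [NormedAddCommGroup H] [InnerProductSpace ℝ H]

/-- The ordered modulus of continuity
`ω(δ; F, G) = sup {Lg - Lf : ‖K(g - f)‖ ≤ δ, f ∈ F, g ∈ G}`, with values in `[-∞, ∞]`. -/
def orderedModulus (K : V →ₗ[ℝ] H) (L : V →ₗ[ℝ] ℝ) (δ : ℝ) (F G : Set V) : EReal :=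
  sSup {x : EReal | ∃ f ∈ F, ∃ g ∈ G, ‖K (g - f)‖ ≤ δ ∧ x = ((L g - L f : ℝ) : EReal)}

/-- The observation `Y = K f + σ ε`, recorded as the family `h ↦ ⟨Y, h⟩`. -/
def observation (K : V →ₗ[ℝ] H) (σ : ℝ) (ε : H → Ω → ℝ) (f : V) (ω : Ω) : H → ℝ :=
  fun h => inner ℝ (K f) h + σ * ε h ω

variable [MeasurableSpace Ω]

/-- `C = C(Y)` is a `1 - α` confidence set for `L f` over `f ∈ F`. A data set is a function
`y : H → ℝ`, `y h = ⟨Y, h⟩`, and `H → ℝ` carries the σ-algebra generated by the evaluations. -/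
def IsConfidenceSet (P : Measure Ω) (ε : H → Ω → ℝ) (K : V →ₗ[ℝ] H) (L : V →ₗ[ℝ] ℝ) (σ : ℝ)
    (F : Set V) (α : ℝ) (C : (H → ℝ) → Set ℝ) : Prop :=
  MeasurableSet {p : (H → ℝ) × ℝ | p.2 ∈ C p.1} ∧
    ENNReal.ofReal (1 - α) ≤ ⨅ f ∈ F, P {ω | L f ∈ C (observation K σ ε f ω)}

/-- The expected length `E_g λ(C(Y))`. -/
def expectedLength (P : Measure Ω) (ε : H → Ω → ℝ) (K : V →ₗ[ℝ] H) (σ : ℝ)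
    (g : V) (C : (H → ℝ) → Set ℝ) : ENNReal :=
  ∫⁻ ω, volume (C (observation K σ ε g ω)) ∂P

/-- `C` minimizes the expected length at `g` among all `1 - α` confidence sets. -/
def IsShortestAt (P : Measure Ω) (ε : H → Ω → ℝ) (K : V →ₗ[ℝ] H) (L : V →ₗ[ℝ] ℝ) (σ : ℝ)
    (F : Set V) (α : ℝ) (g : V) (C : (H → ℝ) → Set ℝ) : Prop :=
  IsConfidenceSet P ε K L σ F α C ∧
    ∀ C' : (H → ℝ) → Set ℝ, IsConfidenceSet P ε K L σ F α C' →
      expectedLength P ε K σ g C ≤ expectedLength P ε K σ g C'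

/-- The test of `f₀` against `g` that rejects for large values of `⟨K(g - f₀), Y⟩`, the critical
value being the `1 - α` quantile of this statistic under `f₀`. -/
def Rejects (P : Measure Ω) (ε : H → Ω → ℝ) (K : V →ₗ[ℝ] H) (σ α : ℝ) (g f₀ : V)
    (y : H → ℝ) : Prop :=
  quantile (P.map fun ω => observation K σ ε f₀ ω (K (g - f₀))) (1 - α) < y (K (g - f₀))

/-- At the parameter value `t`, the set `C` inverts the test above of `f₀` against `g`: almost
surely under every `f ∈ F`, the value `t` is in `C(Y)` iff the test does not reject. -/
def InvertsTestAt (P : Measure Ω) (ε : H → Ω → ℝ) (K : V →ₗ[ℝ] H) (σ : ℝ)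
    (F : Set V) (α : ℝ) (g f₀ : V) (C : (H → ℝ) → Set ℝ) (t : ℝ) : Prop :=
  ∀ f ∈ F, ∀ᵐ ω ∂P, t ∈ C (observation K σ ε f ω) ↔
    ¬ Rejects P ε K σ α g f₀ (observation K σ ε f ω)

/-- `(1 - α) E[ω(σ(z - Z); F, {g}) + ω(σ(z - Z); {g}, F) | Z ≤ z]`, where `Z` is standard normal
and `z` is its `1 - α` quantile. For `g ∈ F` both moduli are nonnegative on the event `Z ≤ z`. -/
def optimalLength (K : V →ₗ[ℝ] H) (L : V →ₗ[ℝ] ℝ) (σ : ℝ) (F : Set V) (α : ℝ) (g : V) : ENNReal :=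
  let z : ℝ := quantile (gaussianReal 0 1) (1 - α)
  ENNReal.ofReal (1 - α) *
    ∫⁻ x, (orderedModulus K L (σ * (z - x)) F {g}
      + orderedModulus K L (σ * (z - x)) {g} F).toENNReal ∂(cond (gaussianReal 0 1) (Set.Iic z))

end

end GaussianLinearModel

end

namespace GaussianLinearModel

open Filter Topology Set
open scoped ENNReal NNReal

/-! ### Quantiles -/

/-! By Tonelli the expected length is the integral over `t` of `P_g(t ∈ C)`, so the problem splits
over `t` (`expectedLength_eq`). For each `t`, the event `t ∈ C` is the acceptance region of a level
`α` test of `f_t`. The law of `Y` under `g` is a Cameron–Martin shift of its law under `f_t`, so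
Neyman–Pearson bounds `P_g(t ∈ C)` below by `Φ(z - ‖K(g - f_t)‖/σ)` (`le_measure_mem`).

The integral of this bound is the stated length. A second use of Tonelli writes it as the mean
length, over `Z ≤ z`, of `{t | ‖K(g - f_t)‖ ≤ σ(z - Z)}`; by convexity this is an interval around
`Lg`, and its extents on either side are the two moduli.

The bound is attained where `Kf_t ≠ Kg`: `f_t` is the projection of `g` onto a convex slice of `F`,
so every `f` in the slice has `⟨K(f - f_t), K(g - f_t)⟩ ≤ 0` and is accepted at least as often as
`f_t` (`inner_nonpos`, `le_measure_not_rejects`). Where `Kf_t = Kg` the test almost surely never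
rejects, although the bound is only `1 - α`; there another acceptance region is used
(`exists_region`). Joint measurability comes from the continuity of `t ↦ K(g - f_t)`. The converse
is the equality case of Neyman–Pearson, and finiteness follows from linear growth of the convex
function `‖K(g - f_t)‖`. -/

lemma quantile_eq_of_forall_lt {μ : Measure ℝ} {p q : ℝ} (h₁ : p ≤ cdf μ q)
    (h₂ : ∀ x < q, cdf μ x < p) : quantile μ p = q :=
  IsLeast.csInf_eq ⟨h₁, fun _ hx => le_of_not_gt fun h => absurd (h₂ _ h) (not_lt.2 hx)⟩

lemma cdf_gaussianReal_strictMono : StrictMono (cdf (gaussianReal 0 1)) := by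
  intro a b hab
  rw [cdf_eq_real, cdf_eq_real, ← Iic_union_Ioc_eq_Iic hab.le,
    measureReal_union (Iic_disjoint_Ioc le_rfl) measurableSet_Ioc]
  have h : (gaussianReal 0 1) (Ioc a b) ≠ 0 := fun h0 => by
    have := gaussianReal_absolutelyContinuous' 0 one_ne_zero h0
    simp only [Real.volume_Ioc, ENNReal.ofReal_eq_zero] at this
    linarith
  have : 0 < (gaussianReal 0 1).real (Ioc a b) :=
    ENNReal.toReal_pos h (measure_ne_top _ _)
  linarith

lemma exists_cdf_gaussianReal_eq {p : ℝ} (h₀ : 0 < p) (h₁ : p < 1) :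
    ∃ z, cdf (gaussianReal 0 1) z = p := by
  have : NullSingletonClass (gaussianReal 0 1) := nullSingletonClass_gaussianReal one_ne_zero
  have hc : Continuous (cdf (gaussianReal 0 1)) := by
    rw [continuous_iff_continuousAt]
    intro x
    have h := (cdf (gaussianReal 0 1)).measure_singleton x
    rw [measure_cdf, measure_singleton, eq_comm, ENNReal.ofReal_eq_zero] at h
    rw [(monotone_cdf _).continuousAt_iff_leftLim_eq_rightLim, StieltjesFunction.rightLim_eq]
    exact le_antisymm ((monotone_cdf _).leftLim_le le_rfl) (by linarith)
  exact mem_range_of_exists_le_of_exists_ge hc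
    ((tendsto_cdf_atBot _).eventually_le_const h₀).exists
    ((tendsto_cdf_atTop _).eventually_const_le h₁).exists

lemma cdf_quantile_gaussianReal {p : ℝ} (h₀ : 0 < p) (h₁ : p < 1) :
    cdf (gaussianReal 0 1) (quantile (gaussianReal 0 1) p) = p := by
  obtain ⟨z, hz⟩ := exists_cdf_gaussianReal_eq h₀ h₁
  rw [quantile_eq_of_forall_lt hz.ge fun x hx => hz ▸ cdf_gaussianReal_strictMono hx, hz]

lemma gaussianReal_Iic_quantile {p : ℝ} (h₀ : 0 < p) (h₁ : p < 1) :
    gaussianReal 0 1 (Iic (quantile (gaussianReal 0 1) p)) = ENNReal.ofReal p := by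
  rw [← ofReal_cdf, cdf_quantile_gaussianReal h₀ h₁]

/-! ### The Neyman–Pearson lemma -/

section NeymanPearson

variable {X : Type*} [MeasurableSpace X] {μ : Measure X} {ρ : X → ℝ≥0∞} {c : ℝ≥0∞} {A B : Set X}

/-- Cancel `A ∩ B` and compare both differences with `c` times their measure. Assuming the
inequality for the differences permits infinite `μ`; Lebesgue measure is used later. -/
lemma lintegral_le_of_measure_diff_le (hρ : Measurable ρ)
    (hA : MeasurableSet A) (hB : MeasurableSet B)
    (hle : ∀ x ∈ A, ρ x ≤ c) (hge : ∀ x ∉ A, c ≤ ρ x) (h : μ (A \ B) ≤ μ (B \ A)) :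
    ∫⁻ x in A, ρ x ∂μ ≤ ∫⁻ x in B, ρ x ∂μ := by
  rw [← lintegral_inter_add_sdiff ρ A hB, ← lintegral_inter_add_sdiff ρ B hA, inter_comm B A]
  gcongr 1
  calc ∫⁻ x in A \ B, ρ x ∂μ ≤ ∫⁻ _ in A \ B, c ∂μ :=
        setLIntegral_mono measurable_const fun x hx => hle x hx.1
    _ = c * μ (A \ B) := by simp
    _ ≤ c * μ (B \ A) := by gcongr
    _ = ∫⁻ _ in B \ A, c ∂μ := by simp
    _ ≤ ∫⁻ x in B \ A, ρ x ∂μ := setLIntegral_mono hρ fun x hx => hge x hx.2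

lemma ae_eq_of_lintegral_eq [IsFiniteMeasure μ] (hρ : Measurable ρ)
    (hA : MeasurableSet A) (hB : MeasurableSet B) (hc : c ≠ ∞)
    (hle : ∀ᵐ x ∂μ, x ∈ A → ρ x < c) (hge : ∀ x ∉ A, c < ρ x) (h : μ A ≤ μ B)
    (hfin : ∫⁻ x in A, ρ x ∂μ ≠ ∞) (heq : ∫⁻ x in B, ρ x ∂μ = ∫⁻ x in A, ρ x ∂μ) :
    A =ᵐ[μ] B := by
  have hd : μ (A \ B) ≤ μ (B \ A) := by
    rw [← measure_inter_add_sdiff A hB, ← measure_inter_add_sdiff B hA, inter_comm B A] at h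
    exact (ENNReal.add_le_add_iff_left (measure_ne_top _ _)).1 h
  have hi : ∫⁻ x in B \ A, ρ x ∂μ = ∫⁻ x in A \ B, ρ x ∂μ := by
    rw [← lintegral_inter_add_sdiff ρ A hB] at hfin heq
    rw [← lintegral_inter_add_sdiff ρ B hA, inter_comm B A] at heq
    exact (ENNReal.add_right_inj (ENNReal.add_ne_top.1 hfin).1).1 heq
  have h1 : ∫⁻ x in A \ B, ρ x ∂μ ≤ c * μ (A \ B) := by
    calc _ ≤ ∫⁻ _ in A \ B, c ∂μ := by
          refine setLIntegral_mono_ae measurable_const.aemeasurable ?_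
          filter_upwards [hle] with x hx hxA using (hx hxA.1).le
      _ = _ := by simp
  -- Otherwise `c μ(B \ A) < ∫_{B \ A} ρ = ∫_{A \ B} ρ ≤ c μ(A \ B) ≤ c μ(B \ A)`.
  have hBA : μ (B \ A) = 0 := by
    by_contra h0
    have : ∫⁻ _ in B \ A, c ∂μ < ∫⁻ x in B \ A, ρ x ∂μ := by
      refine setLIntegral_strict_mono (hB.diff hA) h0 hρ ?_ ?_
      · simpa using ENNReal.mul_ne_top hc (measure_ne_top _ _)
      · exact Eventually.of_forall fun x hx => hge x hx.2
    simp only [lintegral_const, MeasurableSet.univ, Measure.restrict_apply, univ_inter] at this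
    refine absurd (this.trans_le (hi.le.trans (h1.trans ?_))) (lt_irrefl _)
    gcongr
  refine ae_eq_set.2 ⟨le_antisymm (hd.trans hBA.le) bot_le, hBA⟩

end NeymanPearson

/-! ### Gaussian noise -/

section Noise

variable {H Ω : Type*} [NormedAddCommGroup H] [InnerProductSpace ℝ H] [MeasurableSpace Ω]
  {P : Measure Ω} {ε : H → Ω → ℝ}

namespace IsStandardGaussianNoise

lemma measurable_uncurried (hε : IsStandardGaussianNoise P ε) : Measurable fun ω h => ε h ω :=
  measurable_pi_lambda _ hε.measurable

lemma map_zero (hε : IsStandardGaussianNoise P ε) : ∀ᵐ ω ∂P, ε 0 ω = 0 := by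
  filter_upwards [hε.map_smul 0 0] with ω h
  simpa using h

lemma map_sub (hε : IsStandardGaussianNoise P ε) (h k : H) :
    ∀ᵐ ω ∂P, ε (h - k) ω = ε h ω - ε k ω := by
  filter_upwards [hε.map_add (h - k) k] with ω h
  rw [sub_add_cancel] at h
  linarith

lemma map_sum (hε : IsStandardGaussianNoise P ε) {ι : Type*} (s : Finset ι) (a : ι → ℝ)
    (k : ι → H) : ∀ᵐ ω ∂P, ε (∑ i ∈ s, a i • k i) ω = ∑ i ∈ s, a i * ε (k i) ω := by
  classical
  induction s using Finset.induction_on with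
  | empty => simpa using hε.map_zero
  | insert i s hi ih =>
    filter_upwards [ih, hε.map_add (a i • k i) (∑ i ∈ s, a i • k i), hε.map_smul (a i) (k i)]
      with ω h₁ h₂ h₃
    rw [Finset.sum_insert hi, Finset.sum_insert hi, h₂, h₁, h₃]

/-- By almost sure linearity, a linear functional of finitely many coordinates is the noise at a
single vector, whose law is known. -/
lemma map_restrict_map (hε : IsStandardGaussianNoise P ε) [DecidableEq H] (I : Finset H)
    (l : StrongDual ℝ (I → ℝ)) :
    (P.map (fun ω => I.restrict fun h => ε h ω)).map l
      = gaussianReal 0 (‖∑ i : I, l (Pi.single i 1) • (i : H)‖₊ ^ 2) := by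
  rw [Measure.map_map l.continuous.measurable
    (show Measurable fun ω => I.restrict fun h => ε h ω from
      (Finset.measurable_restrict I).comp hε.measurable_uncurried), ← hε.law]
  refine Measure.map_congr ?_
  filter_upwards [hε.map_sum Finset.univ (fun i : I => l (Pi.single i 1)) (fun i : I => (i : H))]
    with ω h
  rw [h, Function.comp_apply, ← ContinuousLinearMap.coe_coe, LinearMap.pi_apply_eq_sum_univ]
  refine Finset.sum_congr rfl fun i _ => ?_
  rw [smul_eq_mul, mul_comm]
  congr 2
  ext j
  simp [Pi.single_apply, eq_comm]

/-- The law of standard Gaussian noise is unique. -/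
lemma map_eq_map (hε : IsStandardGaussianNoise P ε) [IsProbabilityMeasure P]
    {Ω' : Type*} [MeasurableSpace Ω'] {Q : Measure Ω'} [IsProbabilityMeasure Q]
    {ε' : H → Ω' → ℝ} (hε' : IsStandardGaussianNoise Q ε') :
    P.map (fun ω h => ε h ω) = Q.map (fun ω h => ε' h ω) := by
  classical
  have hI : ∀ I : Finset H, P.map (fun ω => I.restrict fun h => ε h ω)
      = Q.map (fun ω => I.restrict fun h => ε' h ω) := by
    intro I
    have := Measure.isProbabilityMeasure_map (μ := P)
      (((Finset.measurable_restrict I).comp hε.measurable_uncurried).aemeasurable)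
    have := Measure.isProbabilityMeasure_map (μ := Q)
      (((Finset.measurable_restrict I).comp hε'.measurable_uncurried).aemeasurable)
    -- Finite-dimensional marginals agree because all their one-dimensional projections do; a
    -- projective limit is unique.
    refine Measure.ext_of_charFunDual ?_
    ext l
    rw [charFunDual_eq_charFun_map_one, charFunDual_eq_charFun_map_one,
      hε.map_restrict_map, hε'.map_restrict_map]
  have h₁ := isProjectiveLimit_map (P := P) (X := ε) hε.measurable_uncurried.aemeasurable
  have h₂ := isProjectiveLimit_map (P := Q) (X := ε') hε'.measurable_uncurried.aemeasurable
  simp_rw [← hI] at h₂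
  exact h₁.unique h₂

/-- The shifted measure of the Cameron–Martin formula. -/
noncomputable def _root_.GaussianLinearModel.shiftedMeasure (P : Measure Ω) (ε : H → Ω → ℝ) (v : H) : Measure Ω :=
  P.withDensity fun ω => ENNReal.ofReal (Real.exp (ε v ω - ‖v‖ ^ 2 / 2))

lemma measurable_density (hε : IsStandardGaussianNoise P ε) (v : H) :
    Measurable fun ω => ENNReal.ofReal (Real.exp (ε v ω - ‖v‖ ^ 2 / 2)) :=
  (Real.measurable_exp.comp ((hε.measurable v).sub_const _)).ennreal_ofReal

lemma integral_exp (hε : IsStandardGaussianNoise P ε) (v : H) :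
    ∫ ω, Real.exp (ε v ω) ∂P = Real.exp (‖v‖ ^ 2 / 2) := by
  have := mgf_gaussianReal (hε.law v) 1
  simpa [mgf] using this

lemma integrable_exp (hε : IsStandardGaussianNoise P ε) (v : H) :
    Integrable (fun ω => Real.exp (ε v ω)) P := by
  by_contra h
  have := hε.integral_exp v
  rw [integral_undef h] at this
  exact absurd this (Real.exp_pos _).ne

lemma isProbabilityMeasure_shiftedMeasure (hε : IsStandardGaussianNoise P ε) (v : H) :
    IsProbabilityMeasure (shiftedMeasure P ε v) := by
  refine ⟨?_⟩
  rw [shiftedMeasure, withDensity_apply _ MeasurableSet.univ, Measure.restrict_univ,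
    ← ofReal_integral_eq_lintegral_ofReal]
  · simp_rw [Real.exp_sub, integral_div, hε.integral_exp]
    simp
  · simp_rw [Real.exp_sub]
    exact (hε.integrable_exp v).div_const _
  · exact Eventually.of_forall fun _ => (Real.exp_pos _).le

lemma shiftedMeasure_absolutelyContinuous (_ : IsStandardGaussianNoise P ε) (v : H) : shiftedMeasure P ε v ≪ P :=
  withDensity_absolutelyContinuous _ _

/-- The density times `exp (t ε k)` is a constant multiple of `exp (ε (v + t k))`, so the Gaussian
exponential moment applies. -/
lemma mgf_shiftedMeasure (hε : IsStandardGaussianNoise P ε) (v k : H) (t : ℝ) :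
    mgf (ε k) (shiftedMeasure P ε v) t = Real.exp (inner ℝ v k * t + ‖k‖ ^ 2 * t ^ 2 / 2) := by
  rw [mgf, shiftedMeasure, integral_withDensity_eq_integral_toReal_smul
    (hε.measurable_density v) (Eventually.of_forall fun _ => ENNReal.ofReal_lt_top)]
  have : ∀ᵐ ω ∂P, (ENNReal.ofReal (Real.exp (ε v ω - ‖v‖ ^ 2 / 2))).toReal •
      Real.exp (t * ε k ω) = Real.exp (ε (v + t • k) ω) / Real.exp (‖v‖ ^ 2 / 2) := by
    filter_upwards [hε.map_add v (t • k), hε.map_smul t k] with ω h₁ h₂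
    rw [ENNReal.toReal_ofReal (Real.exp_pos _).le, smul_eq_mul, ← Real.exp_add, ← Real.exp_sub,
      h₁, h₂]
    congr 1
    ring
  rw [integral_congr_ae this, integral_div, hε.integral_exp, ← Real.exp_sub, norm_add_sq_real,
    inner_smul_right, norm_smul, mul_pow, Real.norm_eq_abs, sq_abs]
  congr 1
  ring

lemma map_shiftedMeasure (hε : IsStandardGaussianNoise P ε) (v k : H) :
    (shiftedMeasure P ε v).map (ε k) = gaussianReal (inner ℝ v k) (‖k‖₊ ^ 2) := by
  have := hε.isProbabilityMeasure_shiftedMeasure v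
  have h : mgf id (gaussianReal (inner ℝ v k) (‖k‖₊ ^ 2)) = mgf (ε k) (shiftedMeasure P ε v) := by
    ext t
    rw [mgf_id_gaussianReal, hε.mgf_shiftedMeasure]
    -- The moment generating function is finite on all of `ℝ`, hence determines the complex one and
    -- with it the law.
    simp
  have h' := eqOn_complexMGF_of_mgf h
  rw [integrableExpSet_id_gaussianReal] at h'
  rw [← Measure.map_id (μ := gaussianReal (inner ℝ v k) (‖k‖₊ ^ 2))]
  refine (Measure.ext_of_complexMGF_eq aemeasurable_id (hε.measurable k).aemeasurable ?_).symm
  ext z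
  exact h' (by simp)

/-- The Cameron–Martin formula: under the shifted measure, the noise is centred at `v`. -/
lemma shift (hε : IsStandardGaussianNoise P ε) (v : H) :
    IsStandardGaussianNoise (shiftedMeasure P ε v) fun k ω => ε k ω - inner ℝ v k where
  measurable k := (hε.measurable k).sub_const _
  map_add h k := by
    filter_upwards [hε.shiftedMeasure_absolutelyContinuous v (hε.map_add h k)] with ω h
    rw [h, inner_add_right]
    ring
  map_smul a k := by
    filter_upwards [hε.shiftedMeasure_absolutelyContinuous v (hε.map_smul a k)] with ω h
    rw [h, inner_smul_right]
    ring
  law k := by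
    have : (fun ω => ε k ω - inner ℝ v k) = (fun x => x - inner ℝ v k) ∘ ε k := rfl
    rw [this, ← Measure.map_map (by fun_prop) (hε.measurable k), hε.map_shiftedMeasure,
      gaussianReal_map_sub_const, sub_self]

lemma measure_le (hε : IsStandardGaussianNoise P ε) {h : H} (hh : h ≠ 0) (x : ℝ) :
    P {ω | ε h ω ≤ x} = gaussianReal 0 1 (Iic (x / ‖h‖)) := by
  have hn : 0 < ‖h‖ := norm_pos_iff.2 hh
  have h₁ : gaussianReal 0 (‖h‖₊ ^ 2) = (gaussianReal 0 1).map (‖h‖ * ·) := by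
    rw [gaussianReal_map_const_mul]
    congr 1
    · simp
    · ext; simp
  have h₂ : P {ω | ε h ω ≤ x} = P.map (ε h) (Iic x) := by
    rw [Measure.map_apply (hε.measurable h) measurableSet_Iic]; rfl
  rw [h₂, hε.law, h₁, Measure.map_apply (by fun_prop) measurableSet_Iic]
  congr 1
  ext y
  simp [le_div_iff₀ hn, mul_comm]

lemma measure_eq (hε : IsStandardGaussianNoise P ε) {h : H} (hh : h ≠ 0) (x : ℝ) :
    P {ω | ε h ω = x} = 0 := by
  have h₂ : P {ω | ε h ω = x} = P.map (ε h) {x} := by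
    rw [Measure.map_apply (hε.measurable h) (measurableSet_singleton x)]; rfl
  have := nullSingletonClass_gaussianReal (μ := 0) (v := ‖h‖₊ ^ 2) (by simpa using hh)
  rw [h₂, hε.law, measure_singleton]

lemma lintegral_sq (hε : IsStandardGaussianNoise P ε) (h : H) :
    ∫⁻ ω, ENNReal.ofReal (ε h ω ^ 2) ∂P = ENNReal.ofReal (‖h‖ ^ 2) := by
  have h₁ : ∫⁻ ω, ENNReal.ofReal (ε h ω ^ 2) ∂P
      = ∫⁻ x, ENNReal.ofReal (x ^ 2) ∂(P.map (ε h)) :=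
    (lintegral_map (f := fun x : ℝ => ENNReal.ofReal (x ^ 2)) (by fun_prop) (hε.measurable h)).symm
  rw [h₁, hε.law, ← ofReal_integral_eq_lintegral_ofReal]
  · have := variance_id_gaussianReal (μ := 0) (v := ‖h‖₊ ^ 2)
    rw [variance_eq_integral aemeasurable_id] at this
    simp only [id, integral_id_gaussianReal, sub_zero] at this
    rw [this]
    simp
  · exact (memLp_id_gaussianReal' 2 (by simp)).integrable_sq
  · exact Eventually.of_forall fun _ => sq_nonneg _

end IsStandardGaussianNoise
end Noise

/-! ### Testing a shift of the noise -/

section Shift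

variable {H Ω : Type*} [NormedAddCommGroup H] [InnerProductSpace ℝ H] [MeasurableSpace Ω]
  {P : Measure Ω} {ε : H → Ω → ℝ}

namespace IsStandardGaussianNoise

lemma measure_le_norm_mul (hε : IsStandardGaussianNoise P ε) {v : H} (hv : v ≠ 0) (z : ℝ) :
    P {ω | ε v ω ≤ ‖v‖ * z} = gaussianReal 0 1 (Iic z) := by
  rw [hε.measure_le hv, mul_div_cancel_left₀ _ (norm_ne_zero_iff.2 hv)]

lemma shiftedMeasure_le_norm_mul (hε : IsStandardGaussianNoise P ε) {v : H} (hv : v ≠ 0) (z : ℝ) :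
    shiftedMeasure P ε v {ω | ε v ω ≤ ‖v‖ * z} = gaussianReal 0 1 (Iic (z - ‖v‖)) := by
  rw [← (hε.shift v).measure_le_norm_mul hv, real_inner_self_eq_norm_sq]
  congr 1
  ext ω
  simp only [mem_ofPred_eq]
  constructor <;> intro h <;> linarith

lemma measurableSet_le (hε : IsStandardGaussianNoise P ε) (v : H) (x : ℝ) :
    MeasurableSet {ω | ε v ω ≤ x} :=
  _root_.measurableSet_le (hε.measurable v) measurable_const

/-- The likelihood ratio increases with `ε v`, so half-spaces in direction `v` are the
Neyman–Pearson acceptance regions. -/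
lemma shiftedMeasure_le_of_measure_le [IsProbabilityMeasure P] (hε : IsStandardGaussianNoise P ε)
    (v : H) (x : ℝ) {S : Set Ω} (hS : MeasurableSet S) (h : P {ω | ε v ω ≤ x} ≤ P S) :
    shiftedMeasure P ε v {ω | ε v ω ≤ x} ≤ shiftedMeasure P ε v S := by
  have hA := hε.measurableSet_le v x
  rw [shiftedMeasure, withDensity_apply _ hA, withDensity_apply _ hS]
  refine lintegral_le_of_measure_diff_le (c := ENNReal.ofReal (Real.exp (x - ‖v‖ ^ 2 / 2)))
    (hε.measurable_density v) hA hS (fun ω hω => ?_) (fun ω hω => ?_) ?_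
  · have : ε v ω ≤ x := hω
    gcongr
  · have : x ≤ ε v ω := (not_le.1 hω).le
    gcongr
  · rw [← measure_inter_add_sdiff _ hS, ← measure_inter_add_sdiff S hA, inter_comm S] at h
    exact (ENNReal.add_le_add_iff_left (measure_ne_top _ _)).1 h

lemma ae_eq_of_shiftedMeasure_eq [IsProbabilityMeasure P] (hε : IsStandardGaussianNoise P ε)
    {v : H} (hv : v ≠ 0) (x : ℝ) {S : Set Ω} (hS : MeasurableSet S)
    (h : P {ω | ε v ω ≤ x} ≤ P S)
    (heq : shiftedMeasure P ε v S = shiftedMeasure P ε v {ω | ε v ω ≤ x}) :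
    {ω | ε v ω ≤ x} =ᵐ[P] S := by
  have hA := hε.measurableSet_le v x
  have := hε.isProbabilityMeasure_shiftedMeasure v
  have hfin := measure_ne_top (shiftedMeasure P ε v) {ω | ε v ω ≤ x}
  rw [shiftedMeasure, withDensity_apply _ hA] at hfin heq
  rw [withDensity_apply _ hS] at heq
  refine ae_eq_of_lintegral_eq (c := ENNReal.ofReal (Real.exp (x - ‖v‖ ^ 2 / 2)))
    (hε.measurable_density v) hA hS ENNReal.ofReal_ne_top ?_ (fun ω hω => ?_) h hfin heq
  · have h0 : ∀ᵐ ω ∂P, ε v ω ≠ x := by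
      simpa [ae_iff] using hε.measure_eq hv x
    filter_upwards [h0] with ω h0 hω
    have : ε v ω < x := lt_of_le_of_ne hω h0
    exact (ENNReal.ofReal_lt_ofReal_iff (Real.exp_pos _)).2 (Real.exp_lt_exp.2 (by linarith))
  · have : x < ε v ω := not_le.1 hω
    exact (ENNReal.ofReal_lt_ofReal_iff (Real.exp_pos _)).2 (Real.exp_lt_exp.2 (by linarith))

end IsStandardGaussianNoise
end Shift

/-! ### The Gaussian linear model -/

section Model

variable {V H Ω : Type*} [AddCommGroup V] [Module ℝ V]
  [NormedAddCommGroup H] [InnerProductSpace ℝ H] [MeasurableSpace Ω]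
  {P : Measure Ω} {ε : H → Ω → ℝ} {K : V →ₗ[ℝ] H} {σ α : ℝ} {g f₀ : V}

lemma measurable_observation (hε : IsStandardGaussianNoise P ε) (f : V) :
    Measurable (observation K σ ε f) :=
  measurable_pi_lambda _ fun h => ((hε.measurable h).const_mul σ).const_add _

/-- Under the shifted measure `ε` is standard noise plus `v`, and the drift `σ v` turns `K f₀` into
`K f`. -/
lemma map_observation_eq [IsProbabilityMeasure P] (hε : IsStandardGaussianNoise P ε)
    {f f₀ : V} {v : H} (hv : σ • v = K (f - f₀)) :
    P.map (observation K σ ε f) = (shiftedMeasure P ε v).map (observation K σ ε f₀) := by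
  have := hε.isProbabilityMeasure_shiftedMeasure v
  have hΦ : Measurable fun (e : H → ℝ) (k : H) => inner ℝ (K f) k + σ * e k :=
    measurable_pi_lambda _ fun h => by fun_prop
  have h₁ := congrArg (Measure.map fun (e : H → ℝ) (k : H) => inner ℝ (K f) k + σ * e k)
    (hε.map_eq_map (hε.shift v))
  rw [Measure.map_map hΦ hε.measurable_uncurried,
    Measure.map_map hΦ (hε.shift v).measurable_uncurried] at h₁
  refine h₁.trans (congrArg (fun X => Measure.map X (shiftedMeasure P ε v)) ?_)
  ext ω k
  have : inner ℝ (K f) k = inner ℝ (K f₀) k + σ * inner ℝ v k := by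
    rw [← real_inner_smul_left, hv, map_sub, inner_sub_left]
    ring
  simp only [observation, Function.comp_apply, this]
  ring

lemma map_observation_absolutelyContinuous [IsProbabilityMeasure P]
    (hε : IsStandardGaussianNoise P ε) (hσ : 0 < σ) (f f₀ : V) :
    P.map (observation K σ ε f) ≪ P.map (observation K σ ε f₀) := by
  rw [map_observation_eq hε (f := f) (f₀ := f₀) (v := σ⁻¹ • K (f - f₀))
    (by rw [smul_smul, mul_inv_cancel₀ hσ.ne', one_smul])]
  exact (hε.shiftedMeasure_absolutelyContinuous _).map (measurable_observation hε f₀)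

lemma measure_observation_le (hε : IsStandardGaussianNoise P ε) (hσ : 0 < σ) {h : H} (hh : h ≠ 0)
    (f : V) (x : ℝ) : P {ω | observation K σ ε f ω h ≤ x}
      = gaussianReal 0 1 (Iic ((x - inner ℝ (K f) h) / (σ * ‖h‖))) := by
  have : {ω | observation K σ ε f ω h ≤ x} = {ω | ε h ω ≤ (x - inner ℝ (K f) h) / σ} := by
    ext ω
    simp only [observation, mem_ofPred_eq, le_div_iff₀ hσ]
    constructor <;> intro h <;> linarith
  rw [this, hε.measure_le hh, div_div]

lemma quantile_observation [IsProbabilityMeasure P] (hε : IsStandardGaussianNoise P ε)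
    (hσ : 0 < σ) {h : H} (hh : h ≠ 0) (f : V) {p : ℝ} (hp₀ : 0 < p) (hp₁ : p < 1) :
    quantile (P.map fun ω => observation K σ ε f ω h) p
      = inner ℝ (K f) h + σ * ‖h‖ * quantile (gaussianReal 0 1) p := by
  have hm : Measurable fun ω => observation K σ ε f ω h :=
    (measurable_pi_apply h).comp (measurable_observation hε f)
  have := Measure.isProbabilityMeasure_map (μ := P) hm.aemeasurable
  have hs : 0 < σ * ‖h‖ := mul_pos hσ (norm_pos_iff.2 hh)
  have hcdf : ∀ x, cdf (P.map fun ω => observation K σ ε f ω h) x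
      = cdf (gaussianReal 0 1) ((x - inner ℝ (K f) h) / (σ * ‖h‖)) := by
    intro x
    rw [cdf_eq_real, cdf_eq_real, measureReal_def, measureReal_def,
      Measure.map_apply hm measurableSet_Iic, ← measure_observation_le hε hσ hh]
    rfl
  have hq := cdf_quantile_gaussianReal hp₀ hp₁
  refine quantile_eq_of_forall_lt ?_ fun x hx => ?_
  · rw [hcdf, add_sub_cancel_left, mul_div_cancel_left₀ _ hs.ne', hq]
  · rw [hcdf]
    refine (cdf_gaussianReal_strictMono ?_).trans_eq hq
    rw [div_lt_iff₀ hs]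
    linarith

lemma rejects_iff [IsProbabilityMeasure P] (hε : IsStandardGaussianNoise P ε) (hσ : 0 < σ)
    (hα₀ : 0 < α) (hα₁ : α < 1) (hh : K (g - f₀) ≠ 0) (y : H → ℝ) :
    Rejects P ε K σ α g f₀ y ↔ inner ℝ (K f₀) (K (g - f₀)) +
      σ * ‖K (g - f₀)‖ * quantile (gaussianReal 0 1) (1 - α) < y (K (g - f₀)) := by
  rw [Rejects, quantile_observation hε hσ hh f₀ (by linarith) (by linarith)]

/-- The statistic and its critical value are then both `0`, and rejection demands strict excess. -/
lemma ae_not_rejects_of_eq_zero [IsProbabilityMeasure P] (hε : IsStandardGaussianNoise P ε)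
    (hα₀ : 0 < α) (hα₁ : α < 1) (hh : K (g - f₀) = 0) (f : V) :
    ∀ᵐ ω ∂P, ¬ Rejects P ε K σ α g f₀ (observation K σ ε f ω) := by
  have hz : ∀ f, ∀ᵐ ω ∂P, observation K σ ε f ω (K (g - f₀)) = 0 := by
    intro f
    filter_upwards [hε.map_zero] with ω h
    simp [observation, hh, h]
  have hq : quantile (P.map fun ω => observation K σ ε f₀ ω (K (g - f₀))) (1 - α) = 0 := by
    have : P.map (fun ω => observation K σ ε f₀ ω (K (g - f₀))) = Measure.dirac 0 := by
      rw [Measure.map_congr (hz f₀), Measure.map_const]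
      simp
    rw [this]
    refine quantile_eq_of_forall_lt ?_ fun x hx => ?_
    · rw [cdf_eq_real]
      simp [measureReal_def, hα₀.le]
    · rw [cdf_eq_real]
      simp [measureReal_def, hx, hα₁]
  filter_upwards [hz f] with ω h
  rw [Rejects, hq, h]
  exact lt_irrefl _

lemma measure_not_rejects [IsProbabilityMeasure P] (hε : IsStandardGaussianNoise P ε) (hσ : 0 < σ)
    (hα₀ : 0 < α) (hα₁ : α < 1) (hh : K (g - f₀) ≠ 0) (f : V) :
    P {ω | ¬ Rejects P ε K σ α g f₀ (observation K σ ε f ω)} = gaussianReal 0 1 (Iic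
      (quantile (gaussianReal 0 1) (1 - α)
        - inner ℝ (K (f - f₀)) (K (g - f₀)) / (σ * ‖K (g - f₀)‖))) := by
  have hs : 0 < σ * ‖K (g - f₀)‖ := mul_pos hσ (norm_pos_iff.2 hh)
  simp_rw [rejects_iff hε hσ hα₀ hα₁ hh, not_lt]
  rw [measure_observation_le hε hσ hh, map_sub K f, inner_sub_left]
  congr 2
  field_simp
  ring

lemma measure_not_rejects_self [IsProbabilityMeasure P] (hε : IsStandardGaussianNoise P ε)
    (hσ : 0 < σ) (hα₀ : 0 < α) (hα₁ : α < 1) (hh : K (g - f₀) ≠ 0) :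
    P {ω | ¬ Rejects P ε K σ α g f₀ (observation K σ ε g ω)} = gaussianReal 0 1 (Iic
      (quantile (gaussianReal 0 1) (1 - α) - ‖K (g - f₀)‖ / σ)) := by
  rw [measure_not_rejects hε hσ hα₀ hα₁ hh, real_inner_self_eq_norm_sq]
  have := norm_pos_iff.2 hh
  congr 3
  field_simp

/-- An obtuse angle means that the statistic has no larger mean under `f` than under `f₀`, with the
same variance. -/
lemma le_measure_not_rejects [IsProbabilityMeasure P] (hε : IsStandardGaussianNoise P ε)
    (hσ : 0 < σ) (hα₀ : 0 < α) (hα₁ : α < 1) (hh : K (g - f₀) ≠ 0) {f : V}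
    (hf : inner ℝ (K (f - f₀)) (K (g - f₀)) ≤ 0) :
    ENNReal.ofReal (1 - α) ≤ P {ω | ¬ Rejects P ε K σ α g f₀ (observation K σ ε f ω)} := by
  rw [measure_not_rejects hε hσ hα₀ hα₁ hh,
    ← gaussianReal_Iic_quantile (p := 1 - α) (by linarith) (by linarith)]
  have : inner ℝ (K (f - f₀)) (K (g - f₀)) / (σ * ‖K (g - f₀)‖) ≤ 0 :=
    div_nonpos_of_nonpos_of_nonneg hf (by positivity)
  exact measure_mono (Iic_subset_Iic.2 (by linarith))

lemma measurableSet_rejects (f₀ : V) : MeasurableSet {y | Rejects P ε K σ α g f₀ y} :=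
  measurableSet_lt measurable_const (measurable_pi_apply _)

lemma exists_smul_eq (hσ : 0 < σ) {h : H} (hh : h ≠ 0) :
    ∃ v : H, v ≠ 0 ∧ σ • v = h ∧ ‖v‖ = ‖h‖ / σ := by
  refine ⟨σ⁻¹ • h, smul_ne_zero (inv_ne_zero hσ.ne') hh, ?_, ?_⟩
  · rw [smul_smul, mul_inv_cancel₀ hσ.ne', one_smul]
  · rw [norm_smul, Real.norm_eq_abs, abs_of_pos (inv_pos.2 hσ), div_eq_inv_mul]

lemma measure_observation_mem [IsProbabilityMeasure P] (hε : IsStandardGaussianNoise P ε)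
    {f f₀ : V} {v : H} (hv : σ • v = K (f - f₀)) {B : Set (H → ℝ)} (hB : MeasurableSet B) :
    P {ω | observation K σ ε f ω ∈ B}
      = shiftedMeasure P ε v {ω | observation K σ ε f₀ ω ∈ B} := by
  have h := congrArg (fun μ => μ B) (map_observation_eq hε hv)
  rwa [Measure.map_apply (measurable_observation hε f) hB,
    Measure.map_apply (measurable_observation hε f₀) hB] at h

/-- The test of `f₀` against `g` is most powerful. -/
lemma measure_accept_le [IsProbabilityMeasure P] (hε : IsStandardGaussianNoise P ε) (hσ : 0 < σ)
    (hα₀ : 0 < α) (hα₁ : α < 1) (hh : K (g - f₀) ≠ 0) {B : Set (H → ℝ)} (hB : MeasurableSet B)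
    (hcov : ENNReal.ofReal (1 - α) ≤ P {ω | observation K σ ε f₀ ω ∈ B}) :
    gaussianReal 0 1 (Iic (quantile (gaussianReal 0 1) (1 - α) - ‖K (g - f₀)‖ / σ))
      ≤ P {ω | observation K σ ε g ω ∈ B} := by
  obtain ⟨v, hv₀, hσv, hn⟩ := exists_smul_eq hσ hh
  have h₁ : P {ω | observation K σ ε g ω ∈ B}
      = shiftedMeasure P ε v {ω | observation K σ ε f₀ ω ∈ B} := measure_observation_mem hε hσv hB
  rw [h₁, ← hn, ← hε.shiftedMeasure_le_norm_mul hv₀]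
  refine hε.shiftedMeasure_le_of_measure_le v _ (measurable_observation hε f₀ hB) ?_
  rw [hε.measure_le_norm_mul hv₀, gaussianReal_Iic_quantile (by linarith) (by linarith)]
  exact hcov

/-- The most powerful test of `f₀` against `g` is almost surely unique. -/
lemma ae_mem_iff_not_rejects [IsProbabilityMeasure P] (hε : IsStandardGaussianNoise P ε)
    (hσ : 0 < σ) (hα₀ : 0 < α) (hα₁ : α < 1) (hh : K (g - f₀) ≠ 0) {B : Set (H → ℝ)}
    (hB : MeasurableSet B)
    (hcov : ENNReal.ofReal (1 - α) ≤ P {ω | observation K σ ε f₀ ω ∈ B})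
    (heq : P {ω | observation K σ ε g ω ∈ B} =
      gaussianReal 0 1 (Iic (quantile (gaussianReal 0 1) (1 - α) - ‖K (g - f₀)‖ / σ))) (f : V) :
    ∀ᵐ ω ∂P, observation K σ ε f ω ∈ B ↔
      ¬ Rejects P ε K σ α g f₀ (observation K σ ε f ω) := by
  -- The laws of `Y` under all parameters are mutually absolutely continuous, so `f₀` suffices.
  suffices h : ∀ᵐ ω ∂P, observation K σ ε f₀ ω ∈ B ↔
      ¬ Rejects P ε K σ α g f₀ (observation K σ ε f₀ ω) by
    have hm : MeasurableSet {y | y ∈ B ↔ ¬ Rejects P ε K σ α g f₀ y} :=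
      MeasurableSet.iff hB (measurableSet_rejects f₀).compl
    have := (ae_map_iff (measurable_observation hε f₀).aemeasurable hm).2 h
    exact ae_of_ae_map (measurable_observation hε f).aemeasurable
      (map_observation_absolutelyContinuous hε hσ f f₀ this)
  obtain ⟨v, hv₀, hσv, hn⟩ := exists_smul_eq hσ hh
  have h₁ : P {ω | observation K σ ε g ω ∈ B}
      = shiftedMeasure P ε v {ω | observation K σ ε f₀ ω ∈ B} := measure_observation_mem hε hσv hB
  rw [h₁, ← hn, ← hε.shiftedMeasure_le_norm_mul hv₀] at heq
  have h₂ := hε.ae_eq_of_shiftedMeasure_eq hv₀ _ (measurable_observation hε f₀ hB) (by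
    rw [hε.measure_le_norm_mul hv₀, gaussianReal_Iic_quantile (by linarith) (by linarith)]
    exact hcov) heq
  filter_upwards [h₂.mem_iff, hε.map_smul σ v] with ω h₂ h₃
  have h₂ : ε v ω ≤ ‖v‖ * quantile (gaussianReal 0 1) (1 - α) ↔ observation K σ ε f₀ ω ∈ B := h₂
  have hn' : ‖K (g - f₀)‖ = σ * ‖v‖ := by rw [hn]; field_simp
  rw [← h₂, rejects_iff hε hσ hα₀ hα₁ hh, not_lt, observation, hn', ← hσv, h₃]
  rw [add_le_add_iff_left, mul_assoc, mul_le_mul_iff_right₀ hσ, mul_assoc,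
    mul_le_mul_iff_right₀ hσ]

end Model

/-! ### Nearest points of given functional value -/

section Geometry

variable {V H : Type*} [AddCommGroup V] [Module ℝ V]
  [NormedAddCommGroup H] [InnerProductSpace ℝ H]
  {K : V →ₗ[ℝ] H} {L : V →ₗ[ℝ] ℝ} {F : Set V} {g : V} {fmin : ℝ → V}

/-- `fmin t` minimizes `‖K (g - f)‖` over the `f ∈ F` with `L f = t`. -/
def IsNearestFamily (K : V →ₗ[ℝ] H) (L : V →ₗ[ℝ] ℝ) (F : Set V) (g : V) (fmin : ℝ → V) : Prop :=
  ∀ t : ℝ, fmin t ∈ F ∧ L (fmin t) = t ∧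
    ∀ f ∈ F, L f = t → ‖K (g - fmin t)‖ ≤ ‖K (g - f)‖

namespace IsNearestFamily

/-- The variational inequality of a projection: a short move from the nearest point towards `f`
stays feasible, and at an acute angle it would come closer to `g`. -/
lemma inner_nonpos (h : IsNearestFamily K L F g fmin) (hF : Convex ℝ F) {f : V} (hf : f ∈ F) :
    inner ℝ (K (f - fmin (L f))) (K (g - fmin (L f))) ≤ 0 := by
  obtain ⟨h₁, h₂, h₃⟩ := h (L f)
  set d := K (f - fmin (L f)) with hd
  set u := K (g - fmin (L f)) with hu
  by_contra! ha
  set a := inner ℝ d u with ha'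
  have hpos : 0 < a + ‖d‖ ^ 2 := by positivity
  -- Minimality will give `2a ≤ s‖d‖²`, whereas this `s` satisfies `s‖d‖² = a - sa < a`; the extra
  -- `a` in the denominator ensures `s ≤ 1`.
  set s := a / (a + ‖d‖ ^ 2) with hs
  have hs₀ : 0 < s := by positivity
  have hs₁ : s ≤ 1 := (div_le_one hpos).2 (by nlinarith [sq_nonneg ‖d‖])
  have hmem := hF h₁ hf (sub_nonneg.2 hs₁) hs₀.le (by ring)
  have hle := h₃ _ hmem (by simp only [map_add, map_smul, h₂, smul_eq_mul]; ring)
  have heq : K (g - ((1 - s) • fmin (L f) + s • f)) = u - s • d := by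
    rw [hu, hd, ← map_smul, ← map_sub]
    congr 1
    module
  rw [heq] at hle
  have hsq := pow_le_pow_left₀ (norm_nonneg u) hle 2
  rw [norm_sub_sq_real, inner_smul_right, real_inner_comm, ← ha', norm_smul, mul_pow,
    Real.norm_eq_abs, sq_abs] at hsq
  have h4 : s * (2 * a) ≤ s * (s * ‖d‖ ^ 2) := by nlinarith
  have h5 := le_of_mul_le_mul_left h4 hs₀
  have h6 : s * (a + ‖d‖ ^ 2) = a := div_mul_cancel₀ _ hpos.ne'
  nlinarith [mul_pos hs₀ ha]

lemma norm_le (h : IsNearestFamily K L F g fmin) {f : V} (hf : f ∈ F) :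
    ‖K (g - fmin (L f))‖ ≤ ‖K (g - f)‖ :=
  (h (L f)).2.2 f hf rfl

lemma map_sub_self (h : IsNearestFamily K L F g fmin) (hg : g ∈ F) : K (g - fmin (L g)) = 0 := by
  simpa using h.norm_le hg

/-- The combination of the two nearest points lies in `F` and competes at the combined value. -/
lemma norm_convexComb_le (h : IsNearestFamily K L F g fmin) (hF : Convex ℝ F) (s t : ℝ) {a b : ℝ}
    (ha : 0 ≤ a) (hb : 0 ≤ b) (hab : a + b = 1) :
    ‖K (g - fmin (a * s + b * t))‖ ≤ ‖a • K (g - fmin s) + b • K (g - fmin t)‖ := by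
  have hle := h.norm_le (hF (h s).1 (h t).1 ha hb hab)
  rw [map_add, map_smul, map_smul, (h s).2.1, (h t).2.1, smul_eq_mul, smul_eq_mul] at hle
  convert hle using 2
  rw [← map_smul, ← map_smul, ← map_add]
  congr 1
  rw [smul_sub, smul_sub, sub_add_sub_comm, ← add_smul, hab, one_smul]

lemma convexOn (h : IsNearestFamily K L F g fmin) (hF : Convex ℝ F) :
    ConvexOn ℝ univ fun t => ‖K (g - fmin t)‖ := by
  refine ⟨convex_univ, fun s _ t _ a b ha hb hab => ?_⟩
  refine (h.norm_convexComb_le hF s t ha hb hab).trans ((norm_add_le _ _).trans_eq ?_)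
  rw [norm_smul, norm_smul, Real.norm_of_nonneg ha, Real.norm_of_nonneg hb, smul_eq_mul,
    smul_eq_mul]

lemma continuous_norm (h : IsNearestFamily K L F g fmin) (hF : Convex ℝ F) :
    Continuous fun t => ‖K (g - fmin t)‖ :=
  continuousOn_univ.1 ((h.convexOn hF).continuousOn isOpen_univ)

/-- The parallelogram law and minimality at the midpoint bound the increment by norms alone, and
these are continuous in the parameter. -/
lemma continuous_map_sub (h : IsNearestFamily K L F g fmin) (hF : Convex ℝ F) :
    Continuous fun t => K (g - fmin t) := by
  have hn := h.continuous_norm hF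
  rw [continuous_iff_continuousAt]
  intro t
  rw [ContinuousAt, tendsto_iff_norm_sub_tendsto_zero]
  have hb : ∀ s, ‖K (g - fmin s) - K (g - fmin t)‖ ≤ √(2 * ‖K (g - fmin s)‖ ^ 2
      + 2 * ‖K (g - fmin t)‖ ^ 2 - 4 * ‖K (g - fmin (2⁻¹ * s + 2⁻¹ * t))‖ ^ 2) := by
    intro s
    refine Real.le_sqrt_of_sq_le ?_
    have h₁ := h.norm_convexComb_le hF s t (a := 2⁻¹) (b := 2⁻¹) (by norm_num) (by norm_num)
      (by norm_num)
    rw [← smul_add, norm_smul, Real.norm_of_nonneg (by norm_num)] at h₁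
    have h₂ := parallelogram_law_with_norm ℝ (K (g - fmin s)) (K (g - fmin t))
    have h₃ := pow_le_pow_left₀ (norm_nonneg _) h₁ 2
    nlinarith
  refine squeeze_zero (fun _ => norm_nonneg _) hb ?_
  have hc : Continuous fun s => √(2 * ‖K (g - fmin s)‖ ^ 2
      + 2 * ‖K (g - fmin t)‖ ^ 2 - 4 * ‖K (g - fmin (2⁻¹ * s + 2⁻¹ * t))‖ ^ 2) := by
    have := hn.comp (show Continuous fun s => 2⁻¹ * s + 2⁻¹ * t by fun_prop)
    have this : Continuous fun s => ‖K (g - fmin (2⁻¹ * s + 2⁻¹ * t))‖ := this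
    exact Real.continuous_sqrt.comp (((continuous_const.mul (hn.pow 2)).add continuous_const).sub
      (continuous_const.mul (this.pow 2)))
  convert hc.tendsto t using 2
  rw [show 2⁻¹ * t + 2⁻¹ * t = t by ring, eq_comm, Real.sqrt_eq_zero']
  apply le_of_eq
  ring

/-! ### The ordered modulus and the optimal length -/

lemma orderedModulus_left (h : IsNearestFamily K L F g fmin) (δ : ℝ) :
    orderedModulus K L δ F {g}
      = ⨆ t ∈ {t | ‖K (g - fmin t)‖ ≤ δ}, ((L g - t : ℝ) : EReal) := by
  rw [orderedModulus, ← sSup_image]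
  congr 1
  ext x
  constructor
  · rintro ⟨f, hf, _, rfl, hle, rfl⟩
    exact ⟨L f, (h.norm_le hf).trans hle, rfl⟩
  · rintro ⟨t, ht, rfl⟩
    exact ⟨fmin t, (h t).1, g, rfl, ht, by rw [(h t).2.1]⟩

lemma orderedModulus_right (h : IsNearestFamily K L F g fmin) (δ : ℝ) :
    orderedModulus K L δ {g} F
      = ⨆ t ∈ {t | ‖K (g - fmin t)‖ ≤ δ}, ((t - L g : ℝ) : EReal) := by
  rw [orderedModulus, ← sSup_image]
  congr 1
  ext x
  constructor
  · rintro ⟨_, rfl, f, hf, hle, rfl⟩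
    rw [map_sub, norm_sub_rev, ← map_sub] at hle
    exact ⟨L f, (h.norm_le hf).trans hle, rfl⟩
  · rintro ⟨t, ht, rfl⟩
    refine ⟨g, rfl, fmin t, (h t).1, ?_, by rw [(h t).2.1]⟩
    rw [map_sub, norm_sub_rev, ← map_sub]
    exact ht

end IsNearestFamily

lemma volume_inter_Ici {S : Set ℝ} (hS : S.OrdConnected) {a : ℝ} (ha : a ∈ S) :
    volume (S ∩ Ici a) = (⨆ t ∈ S, ((t - a : ℝ) : EReal)).toENNReal := by
  set U := ⨆ t ∈ S, ((t - a : ℝ) : EReal) with hU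
  have hmem : ∀ t ∈ S, ((t - a : ℝ) : EReal) ≤ U := fun t ht =>
    le_iSup₂ (f := fun (t : ℝ) (_ : t ∈ S) => ((t - a : ℝ) : EReal)) t ht
  have hU₀ : 0 ≤ U := by simpa using hmem a ha
  apply le_antisymm
  · induction hu : U with
    | bot => simp [hu] at hU₀
    | top => simp
    | coe u =>
      calc volume (S ∩ Ici a) ≤ volume (Icc a (a + u)) := by
            refine measure_mono fun t ht => ⟨ht.2, ?_⟩
            have := hmem t ht.1
            rw [hu, EReal.coe_le_coe_iff] at this
            linarith
        _ = _ := by simp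
  · rw [← EReal.coe_ennreal_le_coe_ennreal_iff, EReal.coe_toENNReal hU₀]
    refine iSup₂_le fun t ht => ?_
    rcases le_total t a with hta | hta
    · refine le_trans ?_ (EReal.coe_ennreal_nonneg _)
      exact_mod_cast sub_nonpos.2 hta
    · have : volume (Icc a t) ≤ volume (S ∩ Ici a) :=
        measure_mono fun x hx => ⟨hS.out ha ht hx, hx.1⟩
      rw [Real.volume_Icc, ← EReal.coe_ennreal_le_coe_ennreal_iff, EReal.coe_ennreal_ofReal,
        max_eq_left (sub_nonneg.2 hta)] at this
      exact this

lemma volume_inter_Iic {S : Set ℝ} (hS : S.OrdConnected) {a : ℝ} (ha : a ∈ S) :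
    volume (S ∩ Iic a) = (⨆ t ∈ S, ((a - t : ℝ) : EReal)).toENNReal := by
  have h := volume_inter_Ici (S := -S) (a := -a)
    (by simpa using hS.preimage_anti (f := fun x : ℝ => -x) fun _ _ h => neg_le_neg h)
    (by simpa using ha)
  have hv : volume (-S ∩ Ici (-a)) = volume (S ∩ Iic a) := by
    rw [← Measure.measure_neg, inter_neg]
    simp
  rw [← hv, h]
  congr 1
  apply le_antisymm
  · refine iSup₂_le fun t ht => ?_
    refine le_iSup₂_of_le (-t) ht ?_
    exact_mod_cast (by linarith)
  · refine iSup₂_le fun t ht => ?_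
    refine le_iSup₂_of_le (-t) (by simpa using ht) ?_
    exact_mod_cast (by linarith)

/-- The length of an interval as the sum of the extents to the left and to the right of `a`. -/
lemma volume_eq_toENNReal_add {S : Set ℝ} (hS : S.OrdConnected) {a : ℝ} (ha : a ∈ S) :
    volume S = ((⨆ t ∈ S, ((a - t : ℝ) : EReal)) + ⨆ t ∈ S, ((t - a : ℝ) : EReal)).toENNReal := by
  rw [EReal.toENNReal_add, ← volume_inter_Ici hS ha, ← volume_inter_Iic hS ha]
  · rw [← measure_inter_add_sdiff S (measurableSet_Iic (a := a))]
    congr 1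
    rw [sdiff_eq, compl_Iic]
    exact measure_congr (EventuallyEq.inter (ae_eq_refl _) Ioi_ae_eq_Ici)
  · exact le_iSup₂_of_le a ha (by simp)
  · exact le_iSup₂_of_le a ha (by simp)

namespace IsNearestFamily

variable {σ α : ℝ}

lemma optimalLength_eq_lintegral_volume (h : IsNearestFamily K L F g fmin) (hF : Convex ℝ F)
    (hg : g ∈ F) (hσ : 0 < σ) (hα₀ : 0 < α) (hα₁ : α < 1) :
    optimalLength K L σ F α g = ∫⁻ x in Iic (quantile (gaussianReal 0 1) (1 - α)),
      volume {t | ‖K (g - fmin t)‖ ≤ σ * (quantile (gaussianReal 0 1) (1 - α) - x)}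
        ∂gaussianReal 0 1 := by
  have hp : 0 < 1 - α := by linarith
  -- The factor `1 - α` cancels the normalization of the conditional law.
  rw [optimalLength, ProbabilityTheory.cond, gaussianReal_Iic_quantile hp (by linarith), lintegral_smul_measure,
    smul_eq_mul, ← mul_assoc, ENNReal.mul_inv_cancel (by simpa using hα₁) ENNReal.ofReal_ne_top,
    one_mul]
  refine setLIntegral_congr_fun measurableSet_Iic fun x hx => ?_
  have hx : x ≤ quantile (gaussianReal 0 1) (1 - α) := hx
  rw [h.orderedModulus_left, h.orderedModulus_right, ← volume_eq_toENNReal_add]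
  · have := (h.convexOn hF).convex_le (σ * (quantile (gaussianReal 0 1) (1 - α) - x))
    simpa using this.ordConnected
  · rw [mem_ofPred_eq, h.map_sub_self hg, norm_zero]
    exact mul_nonneg hσ.le (sub_nonneg.2 hx)

lemma optimalLength_eq (h : IsNearestFamily K L F g fmin) (hF : Convex ℝ F)
    (hg : g ∈ F) (hσ : 0 < σ) (hα₀ : 0 < α) (hα₁ : α < 1) :
    optimalLength K L σ F α g = ∫⁻ t, gaussianReal 0 1
      (Iic (quantile (gaussianReal 0 1) (1 - α) - ‖K (g - fmin t)‖ / σ)) := by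
  rw [h.optimalLength_eq_lintegral_volume hF hg hσ hα₀ hα₁]
  set z := quantile (gaussianReal 0 1) (1 - α)
  set D : Set (ℝ × ℝ) := {p | ‖K (g - fmin p.2)‖ ≤ σ * (z - p.1)} with hD
  have hDm : MeasurableSet D := by
    refine (isClosed_le ?_ (by fun_prop)).measurableSet
    exact (h.continuous_norm hF).comp continuous_snd
  have h₁ := Measure.prod_apply (μ := (gaussianReal 0 1).restrict (Iic z)) (ν := volume) hDm
  have h₂ := Measure.prod_apply_symm (μ := (gaussianReal 0 1).restrict (Iic z)) (ν := volume) hDm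
  refine (h₁.symm.trans h₂).trans (lintegral_congr fun t => ?_)
  -- The section at `t` is `x ≤ z - ‖K (g - fmin t)‖ / σ`, which already implies `x ≤ z`.
  rw [Measure.restrict_apply (measurable_prodMk_right hDm)]
  congr 1
  ext x
  have hn := norm_nonneg (K (g - fmin t))
  simp only [hD, mem_inter_iff, mem_preimage, mem_ofPred_eq, mem_Iic, le_sub_iff_add_le,
    ← le_sub_iff_add_le', div_le_iff₀ hσ]
  constructor
  · rintro ⟨h, -⟩; linarith
  · intro h
    refine ⟨by linarith, ?_⟩
    have : 0 ≤ (z - x) * σ := hn.trans h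
    nlinarith [nonneg_of_mul_nonneg_left this hσ]

/-- Convexity along the segment from `L g`, where the norm vanishes, to `t`, evaluated at distance
one from `L g`. -/
lemma mul_abs_le_norm (h : IsNearestFamily K L F g fmin) (hF : Convex ℝ F) (hg : g ∈ F) {c t : ℝ}
    (h₁ : c ≤ ‖K (g - fmin (L g + 1))‖) (h₂ : c ≤ ‖K (g - fmin (L g - 1))‖)
    (ht : 1 ≤ |t - L g|) : c * |t - L g| ≤ ‖K (g - fmin t)‖ := by
  have hpos : 0 < |t - L g| := by linarith
  set r := |t - L g| with hr
  have hle := h.norm_convexComb_le hF (L g) t (a := 1 - r⁻¹) (b := r⁻¹)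
    (sub_nonneg.2 (inv_le_one_of_one_le₀ ht)) (inv_nonneg.2 hpos.le) (by ring)
  rw [h.map_sub_self hg, smul_zero, zero_add, norm_smul, Real.norm_of_nonneg (inv_nonneg.2 hpos.le),
    inv_mul_eq_div r ‖_‖, le_div_iff₀ hpos] at hle
  refine le_trans (mul_le_mul_of_nonneg_right ?_ hpos.le) hle
  have he : (1 - r⁻¹) * L g + r⁻¹ * t = L g + (t - L g) / r := by field_simp; ring
  rw [he]
  rcases abs_choice (t - L g) with h' | h'
  · rwa [show (t - L g) / r = 1 by rw [← h', ← hr, div_self hpos.ne']]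
  · have : t - L g = - r := by rw [hr, h', neg_neg]
    rwa [this, neg_div, div_self hpos.ne', ← sub_eq_add_neg]

lemma optimalLength_lt_top (h : IsNearestFamily K L F g fmin) (hF : Convex ℝ F)
    (hg : g ∈ F) (hσ : 0 < σ) (hα₀ : 0 < α) (hα₁ : α < 1)
    (hne : ∀ t : ℝ, t ≠ L g → K (fmin t) ≠ K g) : optimalLength K L σ F α g < ⊤ := by
  rw [h.optimalLength_eq_lintegral_volume hF hg hσ hα₀ hα₁]
  set z := quantile (gaussianReal 0 1) (1 - α)
  have hpos : ∀ t, t ≠ L g → 0 < ‖K (g - fmin t)‖ := fun t ht => by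
    rw [norm_pos_iff, map_sub, sub_ne_zero]
    exact (hne t ht).symm
  obtain ⟨c, hc, h₁, h₂⟩ : ∃ c > 0, c ≤ ‖K (g - fmin (L g + 1))‖ ∧ c ≤ ‖K (g - fmin (L g - 1))‖ :=
    ⟨_, lt_min (hpos (L g + 1) (by simp)) (hpos (L g - 1) (by simp)), min_le_left _ _,
      min_le_right _ _⟩
  have hb : ∀ x ∈ Iic z, volume {t | ‖K (g - fmin t)‖ ≤ σ * (z - x)}
      ≤ ENNReal.ofReal (2 * (1 + σ * (z - x) / c)) := by
    intro x hx
    have hδ : 0 ≤ σ * (z - x) := mul_nonneg hσ.le (sub_nonneg.2 hx)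
    calc _ ≤ volume (Metric.closedBall (L g) (1 + σ * (z - x) / c)) := by
          refine measure_mono fun t ht => ?_
          rw [Metric.mem_closedBall, Real.dist_eq]
          have hδc : 0 ≤ σ * (z - x) / c := by positivity
          rcases le_total 1 |t - L g| with h' | h'
          · have h₃ := (h.mul_abs_le_norm hF hg h₁ h₂ h').trans ht
            have := (le_div_iff₀' hc).2 h₃
            linarith
          · linarith
      _ = _ := Real.volume_closedBall _ _
  have hi : Integrable (fun x : ℝ => 2 * (1 + σ * (z - x) / c)) (gaussianReal 0 1) := by
    have hid : Integrable (fun x : ℝ => x) (gaussianReal 0 1) :=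
      (memLp_id_gaussianReal' 1 (by simp)).integrable le_rfl
    exact ((integrable_const 1).add
      ((((integrable_const z).sub hid).const_mul σ).div_const c)).const_mul 2
  exact (setLIntegral_mono' measurableSet_Iic hb).trans_lt
    ((setLIntegral_le_lintegral _ _).trans_lt hi.lintegral_lt_top)

end IsNearestFamily

end Geometry

/-! ### A jointly measurable version of the test statistics -/

section Version

variable {V H Ω : Type*} [AddCommGroup V] [Module ℝ V]
  [NormedAddCommGroup H] [InnerProductSpace ℝ H] [MeasurableSpace Ω]
  {P : Measure Ω} {ε : H → Ω → ℝ}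

/-- The second moments of the errors are summable, so the squared errors are almost surely summable.
-/
lemma IsStandardGaussianNoise.ae_tendsto (hε : IsStandardGaussianNoise P ε) {k : ℕ → H} {h : H}
    (hk : ∀ j, ‖k j - h‖ ≤ (1 / 2) ^ j) :
    ∀ᵐ ω ∂P, Tendsto (fun j => ε (k j) ω) atTop (𝓝 (ε h ω)) := by
  have hm : ∀ j, Measurable fun ω => ENNReal.ofReal (ε (k j - h) ω ^ 2) := fun j =>
    ((hε.measurable _).pow_const 2).ennreal_ofReal
  have hfin : ∫⁻ ω, ∑' j, ENNReal.ofReal (ε (k j - h) ω ^ 2) ∂P ≠ ∞ := by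
    rw [lintegral_tsum fun j => (hm j).aemeasurable]
    simp_rw [hε.lintegral_sq]
    have hs : Summable fun j => ‖k j - h‖ ^ 2 := by
      refine Summable.of_nonneg_of_le (fun j => sq_nonneg _) (fun j => ?_)
        (summable_geometric_two)
      calc ‖k j - h‖ ^ 2 ≤ ((1 / 2) ^ j) ^ 2 := by gcongr; exact hk j
        _ ≤ (1 / 2) ^ j := pow_le_of_le_one (by positivity)
            (pow_le_one₀ (by norm_num) (by norm_num)) two_ne_zero
    exact hs.tsum_ofReal_ne_top
  filter_upwards [ae_lt_top (Measurable.tsum hm) hfin,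
    ae_all_iff.2 fun j => hε.map_sub (k j) h] with ω h₁ h₂
  have h₃ := ENNReal.tendsto_atTop_zero_of_tsum_ne_top h₁.ne
  have h₄ : Tendsto (fun j => ε (k j - h) ω ^ 2) atTop (𝓝 0) := by
    have := (ENNReal.tendsto_toReal ENNReal.zero_ne_top).comp h₃
    simpa [Function.comp_def, ENNReal.toReal_ofReal (sq_nonneg _)] using this
  have h₅ : Tendsto (fun j => ε (k j - h) ω) atTop (𝓝 0) := by
    have := (Real.continuous_sqrt.tendsto 0).comp h₄
    simp only [Function.comp_def, Real.sqrt_sq_eq_abs, Real.sqrt_zero] at this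
    exact (tendsto_zero_iff_abs_tendsto_zero _).2 this
  simp_rw [h₂] at h₅
  simpa using h₅.add_const (ε h ω)

/-- The evaluation `(y, t) ↦ y (u t)` may involve uncountably many coordinates and need not be
jointly measurable. It is replaced by a limit of evaluations at countably many vectors, chosen
measurably in `t` and converging to `u t` geometrically fast. -/
lemma exists_measurable_version (hε : IsStandardGaussianNoise P ε) (K : V →ₗ[ℝ] H) (σ : ℝ)
    {u : ℝ → H} (hu : Continuous u) :
    ∃ T : (H → ℝ) → ℝ → EReal, (Measurable fun p : (H → ℝ) × ℝ => T p.1 p.2) ∧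
      ∀ f t, ∀ᵐ ω ∂P, T (observation K σ ε f ω) t = (observation K σ ε f ω (u t) : EReal) := by
  classical
  set d := TopologicalSpace.denseSeq ℝ
  have hex : ∀ (j : ℕ) (t : ℝ), ∃ n, ‖u (d n) - u t‖ < (1 / 2) ^ j := by
    intro j t
    have ho : IsOpen {s | ‖u s - u t‖ < (1 / 2) ^ j} :=
      isOpen_lt (by fun_prop) continuous_const
    exact (TopologicalSpace.denseRange_denseSeq ℝ).exists_mem_open ho ⟨t, by simp⟩
  set i : ℕ → ℝ → ℕ := fun j t => Nat.find (hex j t) with hi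
  have him : ∀ j, Measurable (i j) := fun j =>
    measurable_find (hex j) fun n =>
      (isOpen_lt (by fun_prop) continuous_const).measurableSet
  refine ⟨fun y t => limsup (fun j => (y (u (d (i j t))) : EReal)) atTop, ?_, fun f t => ?_⟩
  · refine Measurable.limsup fun j => measurable_coe_real_ereal.comp ?_
    have h₁ : Measurable fun p : (H → ℝ) × ℕ => p.1 (u (d p.2)) :=
      measurable_from_prod_countable_left fun n => measurable_pi_apply (u (d n))
    exact h₁.comp (measurable_fst.prodMk ((him j).comp measurable_snd))
  · have hk : ∀ j, ‖u (d (i j t)) - u t‖ ≤ (1 / 2) ^ j := fun j => (Nat.find_spec (hex j t)).le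
    have hlim : Tendsto (fun j => u (d (i j t))) atTop (𝓝 (u t)) := by
      rw [tendsto_iff_norm_sub_tendsto_zero]
      exact squeeze_zero (fun _ => norm_nonneg _) hk
        (tendsto_pow_atTop_nhds_zero_of_lt_one (by norm_num) (by norm_num))
    filter_upwards [hε.ae_tendsto hk] with ω hω
    have h₁ : Tendsto (fun j => observation K σ ε f ω (u (d (i j t)))) atTop
        (𝓝 (observation K σ ε f ω (u t))) :=
      (tendsto_const_nhds.inner hlim).add (hω.const_mul σ)
    exact ((continuous_coe_real_ereal.tendsto _).comp h₁).limsup_eq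

end Version

/-! ### Acceptance regions of constant coverage at a degenerate hypothesis -/

section Region

lemma gaussianReal_zero_one_neg (s : Set ℝ) (hs : MeasurableSet s) :
    gaussianReal 0 1 (-s) = gaussianReal 0 1 s := by
  have h := gaussianReal_map_neg (μ := 0) (v := 1)
  rw [neg_zero] at h
  nth_rw 2 [← h]
  rw [Measure.map_apply measurable_neg hs]
  rfl

lemma measurableSet_lt_abs_add (b c : ℝ) : MeasurableSet {x : ℝ | c < |b + x|} :=
  (isOpen_lt continuous_const (by fun_prop)).measurableSet

lemma exists_gaussianReal_lt_abs_eq {α : ℝ} (hα₀ : 0 < α) (hα₁ : α < 1) :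
    ∃ c, 0 ≤ c ∧ gaussianReal 0 1 {x | c < |x|} = ENNReal.ofReal (1 - α) := by
  -- This leaves mass `(1 - α) / 2` in each tail.
  obtain ⟨c, hc⟩ := exists_cdf_gaussianReal_eq (p := (1 + α) / 2) (by linarith) (by linarith)
  have hIoi : gaussianReal 0 1 (Ioi c) = ENNReal.ofReal ((1 - α) / 2) := by
    rw [← compl_Iic, prob_compl_eq_one_sub measurableSet_Iic, ← ofReal_cdf, hc,
      ← ENNReal.ofReal_one, ← ENNReal.ofReal_sub _ (by linarith)]
    congr 1
    ring
  have hc₀ : 0 ≤ c := by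
    by_contra! hlt
    have h₁ : gaussianReal 0 1 (Iic c) ≤ gaussianReal 0 1 (Ioi c) := by
      rw [← gaussianReal_zero_one_neg _ measurableSet_Iic]
      refine measure_mono fun x hx => ?_
      have : -x ≤ c := hx
      exact mem_Ioi.2 (by linarith)
    rw [hIoi, ← ofReal_cdf, hc, ENNReal.ofReal_le_ofReal_iff (by linarith)] at h₁
    linarith
  refine ⟨c, hc₀, ?_⟩
  have hset : {x : ℝ | c < |x|} = Ioi c ∪ -Ioi c := by
    ext x
    simp [lt_abs, lt_neg]
  rw [hset, measure_union, gaussianReal_zero_one_neg _ measurableSet_Ioi, hIoi,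
    ← ENNReal.ofReal_add (by linarith) (by linarith)]
  · congr 1
    ring
  · rw [Set.disjoint_left]
    intro x hx hx'
    have h₁ : c < x := hx
    have h₂ : c < -x := hx'
    linarith
  · exact measurableSet_Ioi.neg

/-- A symmetric interval has the largest Gaussian probability among its translates. -/
lemma gaussianReal_lt_abs_le {c : ℝ} (hc : 0 ≤ c) (b : ℝ) :
    gaussianReal 0 1 {x | c < |x|} ≤ gaussianReal 0 1 {x | c < |b + x|} := by
  have hA : MeasurableSet {x : ℝ | c < |x|} := by simpa using measurableSet_lt_abs_add 0 c
  have hB := measurableSet_lt_abs_add b c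
  have hmono : ∀ {x y : ℝ}, |x| ≤ |y| → gaussianPDF 0 1 y ≤ gaussianPDF 0 1 x := by
    intro x y hxy
    have := sq_le_sq.2 hxy
    simp only [gaussianPDF, gaussianPDFReal, sub_zero]
    gcongr
  rw [gaussianReal_apply 0 one_ne_zero, gaussianReal_apply 0 one_ne_zero]
  -- The Neyman–Pearson comparison with Lebesgue base measure: the density falls with `|x|`, and the
  -- complementary intervals have equal finite length.
  refine lintegral_le_of_measure_diff_le (c := gaussianPDF 0 1 c) (measurable_gaussianPDF 0 1)
    hA hB (fun x hx => hmono ?_) (fun x hx => hmono ?_) ?_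
  · rw [abs_of_nonneg hc]
    exact le_of_lt hx
  · rw [abs_of_nonneg hc]
    exact not_lt.1 hx
  · have hA' : {x : ℝ | c < |x|}ᶜ = Metric.closedBall 0 c := by
      ext x
      simp
    have hB' : {x : ℝ | c < |b + x|}ᶜ = Metric.closedBall (-b) c := by
      ext x
      simp [Real.dist_eq, add_comm]
    have heq : volume {x : ℝ | c < |x|}ᶜ = volume {x : ℝ | c < |b + x|}ᶜ := by
      rw [hA', hB', Real.volume_closedBall, Real.volume_closedBall]
    have hfin : volume ({x : ℝ | c < |x|}ᶜ ∩ {x : ℝ | c < |b + x|}ᶜ) ≠ ∞ := by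
      refine measure_ne_top_of_subset inter_subset_left ?_
      rw [hA', Real.volume_closedBall]
      exact ENNReal.ofReal_ne_top
    rw [← measure_inter_add_sdiff {x : ℝ | c < |x|}ᶜ hB.compl,
      ← measure_inter_add_sdiff {x : ℝ | c < |b + x|}ᶜ hA.compl,
      inter_comm {x : ℝ | c < |b + x|}ᶜ, ENNReal.add_right_inj hfin] at heq
    rw [sdiff_eq, sdiff_eq, compl_compl, compl_compl, inter_comm, inter_comm _ {x : ℝ | c < |x|}]
      at heq
    rw [sdiff_eq, sdiff_eq, heq]

variable {V H Ω : Type*} [AddCommGroup V] [Module ℝ V]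
  [NormedAddCommGroup H] [InnerProductSpace ℝ H] [MeasurableSpace Ω]
  {P : Measure Ω} {ε : H → Ω → ℝ} {σ α : ℝ}

/-- This is the acceptance region where `K (fmin t) = K g`: the outside of an interval, centred at
its mean under `g`, for one coordinate of `Y`. Moving the mean only raises its probability. In the
trivial space the data carry no information and the whole space is used. -/
lemma exists_region [IsProbabilityMeasure P] (hε : IsStandardGaussianNoise P ε)
    (K : V →ₗ[ℝ] H) (hσ : 0 < σ) (hα₀ : 0 < α) (hα₁ : α < 1) (g : V) :
    ∃ B : Set (H → ℝ), MeasurableSet B ∧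
      (∀ f, ENNReal.ofReal (1 - α) ≤ P {ω | observation K σ ε f ω ∈ B}) ∧
      (Nontrivial H → P {ω | observation K σ ε g ω ∈ B} = ENNReal.ofReal (1 - α)) := by
  rcases subsingleton_or_nontrivial H with hH | hH
  · refine ⟨univ, MeasurableSet.univ, fun f => ?_,
      fun h => absurd hH (not_subsingleton_iff_nontrivial.2 h)⟩
    simp [hα₀.le]
  obtain ⟨e, he⟩ := exists_norm_eq H (zero_le_one (α := ℝ))
  obtain ⟨c, hc₀, hc⟩ := exists_gaussianReal_lt_abs_eq hα₀ hα₁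
  have hlaw : P.map (ε e) = gaussianReal 0 1 := by
    rw [hε.law]
    congr 1
    ext
    simp [he]
  have hP : ∀ f, P {ω | observation K σ ε f ω ∈ {y : H → ℝ | c < |(y e - inner ℝ (K g) e) / σ|}}
      = gaussianReal 0 1 {x | c < |inner ℝ (K (f - g)) e / σ + x|} := by
    intro f
    rw [← hlaw, Measure.map_apply (hε.measurable e) (measurableSet_lt_abs_add _ _)]
    congr 1
    ext ω
    simp only [observation, mem_ofPred_eq, mem_preimage, map_sub, inner_sub_left]
    rw [show (inner ℝ (K f) e + σ * ε e ω - inner ℝ (K g) e) / σ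
      = (inner ℝ (K f) e - inner ℝ (K g) e) / σ + ε e ω by field_simp; ring]
  refine ⟨{y | c < |(y e - inner ℝ (K g) e) / σ|}, ?_, fun f => ?_, fun _ => ?_⟩
  · exact measurableSet_lt measurable_const
      (((measurable_pi_apply e).sub_const _).div_const _).abs
  · rw [hP, ← hc]
    exact gaussianReal_lt_abs_le hc₀ _
  · rw [hP, ← hc]
    simp

end Region

/-! ### Shortest confidence sets -/

section Shortest

lemma measurableSet_mem {X : Type*} [MeasurableSpace X] {C : X → Set ℝ}
    (hC : MeasurableSet {p : X × ℝ | p.2 ∈ C p.1}) (t : ℝ) : MeasurableSet {y | t ∈ C y} :=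
  measurable_prodMk_right hC

variable {V H Ω : Type*} [AddCommGroup V] [Module ℝ V]
  [NormedAddCommGroup H] [InnerProductSpace ℝ H] [MeasurableSpace Ω]
  {P : Measure Ω} {ε : H → Ω → ℝ} {K : V →ₗ[ℝ] H} {L : V →ₗ[ℝ] ℝ}
  {F : Set V} {σ α : ℝ} {g : V} {fmin : ℝ → V} {C : (H → ℝ) → Set ℝ}

lemma expectedLength_eq [SFinite P] (hε : IsStandardGaussianNoise P ε)
    (hC : MeasurableSet {p : (H → ℝ) × ℝ | p.2 ∈ C p.1}) :
    expectedLength P ε K σ g C = ∫⁻ t, P {ω | t ∈ C (observation K σ ε g ω)} := by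
  have hm : Measurable fun p : Ω × ℝ => (observation K σ ε g p.1, p.2) :=
    ((measurable_observation hε g).comp measurable_fst).prodMk measurable_snd
  have h₁ := Measure.prod_apply (μ := P) (ν := volume) (hm hC)
  have h₂ := Measure.prod_apply_symm (μ := P) (ν := volume) (hm hC)
  exact h₁.symm.trans h₂

lemma measurable_measure_mem [SFinite P] (hε : IsStandardGaussianNoise P ε)
    (hC : MeasurableSet {p : (H → ℝ) × ℝ | p.2 ∈ C p.1}) :
    Measurable fun t => P {ω | t ∈ C (observation K σ ε g ω)} := by
  have hm : Measurable fun p : Ω × ℝ => (observation K σ ε g p.1, p.2) :=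
    ((measurable_observation hε g).comp measurable_fst).prodMk measurable_snd
  exact measurable_measure_prodMk_right (hm hC)

lemma observation_congr {Ω : Type*} {ε : H → Ω → ℝ} {f f' : V} (h : K f = K f') :
    observation K σ ε f = observation K σ ε f' := by
  funext ω k
  rw [observation, observation, h]

lemma map_sub_ne_zero_iff {f : V} : K (g - f) ≠ 0 ↔ K f ≠ K g := by
  rw [map_sub, sub_ne_zero, ne_comm]

lemma IsConfidenceSet.le_measure (hC : IsConfidenceSet P ε K L σ F α C) {f : V} (hf : f ∈ F) :
    ENNReal.ofReal (1 - α) ≤ P {ω | L f ∈ C (observation K σ ε f ω)} :=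
  hC.2.trans (iInf₂_le f hf)

variable [IsProbabilityMeasure P]

namespace IsNearestFamily

/-- Coverage at `fmin t` feeds Neyman–Pearson; if `K (fmin t) = K g` the two laws coincide and the
bound is the coverage itself. -/
lemma le_measure_mem (h : IsNearestFamily K L F g fmin) (hε : IsStandardGaussianNoise P ε)
    (hσ : 0 < σ) (hα₀ : 0 < α) (hα₁ : α < 1) (hC : IsConfidenceSet P ε K L σ F α C) (t : ℝ) :
    gaussianReal 0 1 (Iic (quantile (gaussianReal 0 1) (1 - α) - ‖K (g - fmin t)‖ / σ))
      ≤ P {ω | t ∈ C (observation K σ ε g ω)} := by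
  have hcov := hC.le_measure (h t).1
  rw [(h t).2.1] at hcov
  by_cases ht : K (g - fmin t) = 0
  · rw [ht, norm_zero, zero_div, sub_zero, gaussianReal_Iic_quantile (by linarith) (by linarith)]
    rw [map_sub, sub_eq_zero] at ht
    rwa [observation_congr ht]
  · exact measure_accept_le hε hσ hα₀ hα₁ ht (measurableSet_mem hC.1 t) hcov

lemma optimalLength_le (h : IsNearestFamily K L F g fmin) (hε : IsStandardGaussianNoise P ε)
    (hF : Convex ℝ F) (hg : g ∈ F) (hσ : 0 < σ) (hα₀ : 0 < α) (hα₁ : α < 1)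
    (hC : IsConfidenceSet P ε K L σ F α C) :
    optimalLength K L σ F α g ≤ expectedLength P ε K σ g C := by
  rw [h.optimalLength_eq hF hg hσ hα₀ hα₁, expectedLength_eq hε hC.1]
  exact lintegral_mono fun t => h.le_measure_mem hε hσ hα₀ hα₁ hC t

lemma isShortestAt (h : IsNearestFamily K L F g fmin) (hε : IsStandardGaussianNoise P ε)
    (hF : Convex ℝ F) (hg : g ∈ F) (hσ : 0 < σ) (hα₀ : 0 < α) (hα₁ : α < 1)
    (hC : IsConfidenceSet P ε K L σ F α C)
    (hlen : expectedLength P ε K σ g C = optimalLength K L σ F α g) :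
    IsShortestAt P ε K L σ F α g C :=
  ⟨hC, fun _ hC' => hlen.trans_le (h.optimalLength_le hε hF hg hσ hα₀ hα₁ hC')⟩

lemma expectedLength_eq_optimalLength (h : IsNearestFamily K L F g fmin)
    (hε : IsStandardGaussianNoise P ε)
    (hF : Convex ℝ F) (hg : g ∈ F) (hσ : 0 < σ) (hα₀ : 0 < α) (hα₁ : α < 1)
    (hC : MeasurableSet {p : (H → ℝ) × ℝ | p.2 ∈ C p.1})
    (heq : ∀ t, t ≠ L g → P {ω | t ∈ C (observation K σ ε g ω)}
      = gaussianReal 0 1 (Iic (quantile (gaussianReal 0 1) (1 - α) - ‖K (g - fmin t)‖ / σ))) :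
    expectedLength P ε K σ g C = optimalLength K L σ F α g := by
  rw [h.optimalLength_eq hF hg hσ hα₀ hα₁, expectedLength_eq hε hC]
  refine lintegral_congr_ae ?_
  -- The value `L g` may be covered with probability above the bound, at no cost in length.
  filter_upwards [compl_mem_ae_iff.2 (measure_singleton (L g))] with t ht
  exact heq t ht

lemma le_measure_of_inverts (h : IsNearestFamily K L F g fmin) (hε : IsStandardGaussianNoise P ε)
    (hF : Convex ℝ F) (hσ : 0 < σ) (hα₀ : 0 < α) (hα₁ : α < 1) {f : V} (hf : f ∈ F)
    (hinv : InvertsTestAt P ε K σ F α g (fmin (L f)) C (L f)) :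
    ENNReal.ofReal (1 - α) ≤ P {ω | L f ∈ C (observation K σ ε f ω)} := by
  have h₁ : P {ω | L f ∈ C (observation K σ ε f ω)}
      = P {ω | ¬ Rejects P ε K σ α g (fmin (L f)) (observation K σ ε f ω)} :=
    measure_congr (eventuallyEq_set.2 (hinv f hf))
  rw [h₁]
  by_cases ht : K (g - fmin (L f)) = 0
  · have h₂ := ae_not_rejects_of_eq_zero (σ := σ) hε hα₀ hα₁ ht f
    have h₃ : P {ω | ¬ Rejects P ε K σ α g (fmin (L f)) (observation K σ ε f ω)} = 1 := by
      rw [measure_congr (eventuallyEq_univ.2 h₂), measure_univ]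
    rw [h₃]
    simp [hα₀.le]
  · exact le_measure_not_rejects hε hσ hα₀ hα₁ ht (h.inner_nonpos hF hf)

lemma measure_mem_of_inverts (hε : IsStandardGaussianNoise P ε)
    (hg : g ∈ F) (hσ : 0 < σ) (hα₀ : 0 < α) (hα₁ : α < 1) {t : ℝ} (ht : K (g - fmin t) ≠ 0)
    (hinv : InvertsTestAt P ε K σ F α g (fmin t) C t) :
    P {ω | t ∈ C (observation K σ ε g ω)}
      = gaussianReal 0 1 (Iic (quantile (gaussianReal 0 1) (1 - α) - ‖K (g - fmin t)‖ / σ)) := by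
  rw [← measure_not_rejects_self hε hσ hα₀ hα₁ ht]
  exact measure_congr (eventuallyEq_set.2 (hinv g hg))

/-- A shortest confidence set. -/
lemma exists_isShortestAt (h : IsNearestFamily K L F g fmin) (hε : IsStandardGaussianNoise P ε)
    (hF : Convex ℝ F) (hg : g ∈ F) (hσ : 0 < σ) (hα₀ : 0 < α) (hα₁ : α < 1) :
    ∃ C : (H → ℝ) → Set ℝ, IsShortestAt P ε K L σ F α g C ∧
      (∀ t : ℝ, (K (fmin t) ≠ K g ∨ t = L g) → InvertsTestAt P ε K σ F α g (fmin t) C t) ∧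
      expectedLength P ε K σ g C = optimalLength K L σ F α g := by
  have hu := h.continuous_map_sub hF
  obtain ⟨T, hTm, hT⟩ := exists_measurable_version hε K σ hu
  obtain ⟨B, hBm, hB, hBg⟩ := exists_region hε K hσ hα₀ hα₁ g
  set z := quantile (gaussianReal 0 1) (1 - α) with hz
  set q : ℝ → ℝ := fun t => inner ℝ (K (fmin t)) (K (g - fmin t)) + σ * ‖K (g - fmin t)‖ * z with hq
  have hqm : Measurable q := by
    have : q = fun t => inner ℝ (K g - K (g - fmin t)) (K (g - fmin t))
        + σ * ‖K (g - fmin t)‖ * z := by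
      ext t
      have hk : K g - K (g - fmin t) = K (fmin t) := by rw [map_sub, sub_sub_cancel]
      rw [hq, hk]
    rw [this]
    exact Continuous.measurable (((continuous_const.sub hu).inner hu).add
      ((continuous_const.mul hu.norm).mul continuous_const))
  -- `L g` is always included, since its test almost surely never rejects; other degenerate values
  -- use `B` so that no length is wasted.
  set C : (H → ℝ) → Set ℝ := fun y => {t | t = L g ∨ (K (g - fmin t) ≠ 0 ∧ T y t ≤ (q t : EReal)) ∨
    (K (g - fmin t) = 0 ∧ y ∈ B)} with hCdef
  have hzero : MeasurableSet {t | K (g - fmin t) = 0} :=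
    (isClosed_eq hu continuous_const).measurableSet
  have hCm : MeasurableSet {p : (H → ℝ) × ℝ | p.2 ∈ C p.1} := by
    refine (measurableSet_eq_fun measurable_snd measurable_const).union
      (((measurable_snd hzero.compl).inter (measurableSet_le hTm ?_)).union
      ((measurable_snd hzero).inter (measurable_fst hBm)))
    exact measurable_coe_real_ereal.comp (hqm.comp measurable_snd)
  have hinv : ∀ t : ℝ, (K (fmin t) ≠ K g ∨ t = L g) →
      InvertsTestAt P ε K σ F α g (fmin t) C t := by
    intro t ht f hf
    by_cases hLg : t = L g
    · filter_upwards [ae_not_rejects_of_eq_zero (σ := σ) hε hα₀ hα₁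
        (hLg ▸ h.map_sub_self hg : K (g - fmin t) = 0) f] with ω hω
      exact iff_of_true (Or.inl hLg) hω
    · have ht' : K (g - fmin t) ≠ 0 := map_sub_ne_zero_iff.2 (ht.resolve_right hLg)
      filter_upwards [hT f t] with ω hω
      rw [rejects_iff hε hσ hα₀ hα₁ ht', not_lt]
      simp only [hCdef, mem_ofPred_eq, hLg, ht', hω, false_or, ne_eq, not_false_eq_true, true_and,
        false_and, or_false, EReal.coe_le_coe_iff]
      rfl
  have hCc : IsConfidenceSet P ε K L σ F α C := by
    refine ⟨hCm, le_iInf₂ fun f hf => ?_⟩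
    by_cases ht : K (g - fmin (L f)) = 0
    · refine (hB f).trans (measure_mono fun ω hω => ?_)
      exact Or.inr (Or.inr ⟨ht, hω⟩)
    · exact h.le_measure_of_inverts hε hF hσ hα₀ hα₁ hf
        (hinv _ (Or.inl (map_sub_ne_zero_iff.1 ht)))
  have hlen : expectedLength P ε K σ g C = optimalLength K L σ F α g := by
    -- In the trivial space every value is degenerate and the lower bound is already infinite.
    rcases subsingleton_or_nontrivial H with hH | hH
    · refine le_antisymm ?_ (h.optimalLength_le hε hF hg hσ hα₀ hα₁ hCc)
      have : optimalLength K L σ F α g = ⊤ := by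
        have h0 : ∀ t, K (g - fmin t) = 0 := fun t => Subsingleton.elim _ _
        rw [h.optimalLength_eq hF hg hσ hα₀ hα₁]
        simp_rw [h0, norm_zero, zero_div, sub_zero,
          gaussianReal_Iic_quantile (p := 1 - α) (by linarith) (by linarith), lintegral_const,
          Real.volume_univ]
        exact ENNReal.mul_top (by simpa using hα₁)
      rw [this]
      exact le_top
    · refine h.expectedLength_eq_optimalLength hε hF hg hσ hα₀ hα₁ hCm fun t hLg => ?_
      by_cases ht : K (g - fmin t) = 0
      · rw [ht, norm_zero, zero_div, sub_zero, gaussianReal_Iic_quantile (by linarith) (by linarith),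
          ← hBg hH]
        simp only [hCdef, mem_ofPred_eq, hLg, ht, false_or, ne_eq, not_true_eq_false, false_and,
          true_and]
      · exact measure_mem_of_inverts hε hg hσ hα₀ hα₁ ht
          (hinv t (Or.inl (map_sub_ne_zero_iff.1 ht)))
  exact ⟨C, h.isShortestAt hε hF hg hσ hα₀ hα₁ hCc hlen, hinv, hlen⟩

lemma ae_invertsTestAt (h : IsNearestFamily K L F g fmin) (hε : IsStandardGaussianNoise P ε)
    (hF : Convex ℝ F) (hg : g ∈ F) (hσ : 0 < σ) (hα₀ : 0 < α) (hα₁ : α < 1)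
    (hC : IsShortestAt P ε K L σ F α g C) (hfin : expectedLength P ε K σ g C ≠ ⊤) :
    ∀ᵐ t : ℝ, K (fmin t) ≠ K g → InvertsTestAt P ε K σ F α g (fmin t) C t := by
  obtain ⟨C₀, hC₀, -, hlen⟩ := h.exists_isShortestAt hε hF hg hσ hα₀ hα₁
  have hle : expectedLength P ε K σ g C ≤ optimalLength K L σ F α g :=
    (hC.2 C₀ hC₀.1).trans_eq hlen
  rw [h.optimalLength_eq hF hg hσ hα₀ hα₁] at hle
  rw [expectedLength_eq hε hC.1.1] at hle hfin
  -- Pointwise domination and equal finite integrals force equality at almost every `t`; uniqueness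
  -- of the most powerful test then applies.
  have hae := ae_eq_of_ae_le_of_lintegral_le
    (Eventually.of_forall fun t => h.le_measure_mem hε hσ hα₀ hα₁ hC.1 t)
    (ne_top_of_le_ne_top hfin
      (lintegral_mono fun t => h.le_measure_mem hε hσ hα₀ hα₁ hC.1 t))
    (measurable_measure_mem hε hC.1.1).aemeasurable hle
  filter_upwards [hae] with t ht hne f _
  have hcov := hC.1.le_measure (h t).1
  rw [(h t).2.1] at hcov
  exact ae_mem_iff_not_rejects hε hσ hα₀ hα₁ (map_sub_ne_zero_iff.2 hne)
    (measurableSet_mem hC.1.1 t) hcov ht.symm f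

lemma isShortestAt_of_inverts (h : IsNearestFamily K L F g fmin)
    (hε : IsStandardGaussianNoise P ε)
    (hF : Convex ℝ F) (hg : g ∈ F) (hσ : 0 < σ) (hα₀ : 0 < α) (hα₁ : α < 1)
    (hne : ∀ t : ℝ, t ≠ L g → K (fmin t) ≠ K g)
    (hC : MeasurableSet {p : (H → ℝ) × ℝ | p.2 ∈ C p.1})
    (hinv : ∀ t : ℝ, InvertsTestAt P ε K σ F α g (fmin t) C t) :
    IsShortestAt P ε K L σ F α g C ∧
      expectedLength P ε K σ g C = optimalLength K L σ F α g := by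
  have hlen : expectedLength P ε K σ g C = optimalLength K L σ F α g :=
    h.expectedLength_eq_optimalLength hε hF hg hσ hα₀ hα₁ hC fun t ht =>
      measure_mem_of_inverts hε hg hσ hα₀ hα₁ (map_sub_ne_zero_iff.2 (hne t ht)) (hinv t)
  refine ⟨h.isShortestAt hε hF hg hσ hα₀ hα₁ ⟨hC, le_iInf₂ fun f hf => ?_⟩ hlen, hlen⟩
  exact h.le_measure_of_inverts hε hF hσ hα₀ hα₁ hf (hinv _)

end IsNearestFamily

end Shortest

end GaussianLinearModel

open GaussianLinearModel in
theorem theorem3p4 {V H Ω : Type*} [AddCommGroup V] [Module ℝ V]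
    [NormedAddCommGroup H] [InnerProductSpace ℝ H] [CompleteSpace H]
    [MeasurableSpace Ω] (P : Measure Ω) [IsProbabilityMeasure P]
    (ε : H → Ω → ℝ) (hε : IsStandardGaussianNoise P ε)
    (K : V →ₗ[ℝ] H) (L : V →ₗ[ℝ] ℝ) (F : Set V) (hF : Convex ℝ F)
    (σ : ℝ) (hσ : 0 < σ) (α : ℝ) (hα₀ : 0 < α) (hα₁ : α < 1)
    (g : V) (hg : g ∈ F) (fmin : ℝ → V)
    (hfmin : ∀ t : ℝ, fmin t ∈ F ∧ L (fmin t) = t ∧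
      ∀ f ∈ F, L f = t → ‖K (g - fmin t)‖ ≤ ‖K (g - f)‖) :
    -- a shortest confidence set exists, inverts the tests, and has the stated expected length
    (∃ C : (H → ℝ) → Set ℝ, IsShortestAt P ε K L σ F α g C ∧
      (∀ t : ℝ, (K (fmin t) ≠ K g ∨ t = L g) → InvertsTestAt P ε K σ F α g (fmin t) C t) ∧
      expectedLength P ε K σ g C = optimalLength K L σ F α g) ∧
    -- every shortest confidence set inverts these tests
    (∀ C : (H → ℝ) → Set ℝ, IsShortestAt P ε K L σ F α g C → expectedLength P ε K σ g C ≠ ⊤ →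
      ∀ᵐ t : ℝ, K (fmin t) ≠ K g → InvertsTestAt P ε K σ F α g (fmin t) C t) ∧
    -- if no test statistic is degenerate, then inverting the tests gives a shortest confidence set
    ((∀ t : ℝ, t ≠ L g → K (fmin t) ≠ K g) →
      optimalLength K L σ F α g < ⊤ ∧
      ∀ C : (H → ℝ) → Set ℝ, MeasurableSet {p : (H → ℝ) × ℝ | p.2 ∈ C p.1} →
        (∀ t : ℝ, InvertsTestAt P ε K σ F α g (fmin t) C t) →
        IsShortestAt P ε K L σ F α g C ∧
          expectedLength P ε K σ g C = optimalLength K L σ F α g) := by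
  have h : IsNearestFamily K L F g fmin := hfmin
  exact ⟨h.exists_isShortestAt hε hF hg hσ hα₀ hα₁,
    fun _ hC hfin => h.ae_invertsTestAt hε hF hg hσ hα₀ hα₁ hC hfin,
    fun hne => ⟨h.optimalLength_lt_top hF hg hσ hα₀ hα₁ hne,
      fun _ hC hinv => h.isShortestAt_of_inverts hε hF hg hσ hα₀ hα₁ hne hC hinv⟩⟩
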